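/- **Setting.** Let $\mathbb{W}\mathrm{eil}$ be the monoidal category whose objects are the iterated tensor products (over $\mathbb N$) of the commutative $\mathbb N$-algebras $W^n=\mathbb N[x_1,\dots,x_n]/(x_ix_j)_{1\le i,j\le n}$ and of $\mathbb N$, and whose morphisms are all homomorphisms of unital $\mathbb N$-algebras; write $W=W^1$. A $\mathbb{W}\mathrm{eil}$-actegory is a category $\mathbb X$ with a (coherently associative and unital) left action $T_\bullet:\mathbb{W}\mathrm{eil}\times\mathbb X\to\mathbb X$; write $T_A=T_\bullet(A,-)$, $T=T_W$, $T_n=T_{W^n}$, and $p:T\to 1$, $0:1\to T$, $+:T_2\to T$, $\ell:T\to T^2$, $\nu:T_2\to T^2$ for the natural transformations induced by $x\mapsto 0$, by $\mathbb N\subset W$, by $x_1,x_2\mapsto x$, by $x\mapsto x\otimes x$, and by $x_1\mapsto x\otimes x,\ x_2\mapsto 1\otimes x$; more generally $0:1\to T_A$ is induced by $\mathbb N\to A$. It is a *tangent actegory* if for all objects $Z$ and all $k,n\ge 0$: $T^kT_nZ$ is the $n$-th pullback power of $T^k(p_Z)$ (with projections induced by the projections $W^n\to W$), and $T^k$ applied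 to the square $T(p_Z)\circ\nu_Z=0_Z\circ(T_2Z\to Z)$ is a pullback. Let $(\mathbb X,T_\bullet)$ be a tangent actegory. A *differential bundle* $(E,M,q,\zeta,\sigma,\lambda)$ in $\mathbb X$ consists of a morphism $q:E\to M$ with chosen pullback powers $E_n$ ($n\ge 0$), preserved by all $T^k$; morphisms $\zeta:M\to E$ and $\sigma:E_2\to E$ making $q$ an additive bundle (a commutative monoid over $M$); and a morphism $\lambda:E\to TE$ such that $(\lambda,0):(E,M,q,\zeta,\sigma)\to(TE,TM,Tq,T\zeta,T\sigma)$ and $(\lambda,\zeta):(E,M,q,\zeta,\sigma)\to(TE,E,p,0,+)$ are additive bundle morphisms, $\ell_E\circ\lambda=T(\lambda)\circ\lambda$, and the square with top $T(\sigma)\circ\langle\lambda\pi_0,0\pi_1\rangle:E_2\to TE$, left side $q\pi_0:E_2\to M$, right side $T(q):TE\to TM$ and bottom $0:M\to TM$ is a pullback preserved by all powers of $T$. Let $\mathbb N^\bullet$ be the category with objects $\mathbb N^k$ ($k\ge 0$), with morphisms $\mathbb N^m\to\mathbb N^n$ the $n\times m$ matrices over $\mathbb N$, and with the $\mathbb{W}\mathrm{eil}$-action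 $D_A(\mathbb N^k)=A\otimes\mathbb N^k$, where $A\otimes\mathbb N^k$ is identified with a power of $\mathbb N$ through the monomial basis of $A$ (so $D_W(\mathbb N^k)=\mathbb N^k\times\mathbb N^k$), and $D$ of a pair of morphisms is the tensor (Kronecker) product of their matrices. Given a differential bundle, let $F_E:\mathbb N^\bullet\to\mathbb X$ be the functor $F_E(\mathbb N^k)=E_k$, $F_E(a_{ij})=\langle\sum_j a_{1j}\cdot\pi_j,\dots,\sum_j a_{nj}\cdot\pi_j\rangle$, the sums being formed in the commutative monoids of morphisms over $M$ into $E$. Define $\hat\alpha_{A,\mathbb N^l}:F_E(D_A(\mathbb N^l))\to T_A(F_E(\mathbb N^l))$ inductively, where all identifications below are the canonical ones: - $\hat\alpha_{\mathbb N,\mathbb N^l}=1_{E_l}$; - $\hat\alpha_{W,\mathbb N^1}=T(\sigma)\circ\langle 0\circ\pi_0,\lambda\circ\pi_1\rangle:E_2\to TE$; - $\hat\alpha_{W^n,\mathbb N^1}:E_{n+1}\to T_nE$ is the $n$-th pullback power over $E$ of $\hat\alpha_{W,\mathbb N^1}$, where $E_{n+1}$ is regarded as the $n$-th pullback power of $\pi_0:E_2\to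 E$; - $\hat\alpha_{W^n,\mathbb N^l}:E_{(n+1)l}\to T_n(E_l)$ is the $l$-th pullback power of $\hat\alpha_{W^n,\mathbb N^1}$ over $0:M\to T_nM$ (in particular $\hat\alpha_{W^n,\mathbb N^0}=0$); - $\hat\alpha_{A\otimes B,\mathbb N^l}=T_A(\hat\alpha_{B,\mathbb N^l})\circ\hat\alpha_{A,D_B(\mathbb N^l)}$. **Proposition.** For every differential bundle $(E,M,q,\zeta,\sigma,\lambda)$ in a tangent actegory $(\mathbb X,T_\bullet)$, the pair $(F_E,\hat\alpha)$ is a lax differential functor $(\mathbb N^\bullet,D_\bullet)\to(\mathbb X,T_\bullet)$. That is: 1. $(F_E,\hat\alpha)$ is an oplax $\mathbb{W}\mathrm{eil}$-linear functor: $\hat\alpha:F_E\circ D_\bullet\Rightarrow T_\bullet\circ(1\times F_E)$ is natural in both variables, i.e. on $\mathbb{W}\mathrm{eil}\times\mathbb N^\bullet$, and satisfies the two coherence laws of a lineator (for tensor products and for the unit); 2. for every object $A$ of $\mathbb{W}\mathrm{eil}$, the functor $T_A\circ F_E$ preserves pullbacks over the terminal object; 3. for every object $A$ of $\mathbb{W}\mathrm{eil}$,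 the transformation $\hat\alpha_{A,-}$ is Cartesian: its naturality square at every morphism of $\mathbb N^\bullet$ is a pullback. -/

import Mathlib

open CategoryTheory MonoidalCategory TensorProduct

universe v u

/-! ### The category of Weil algebras -/

/-- Formal objects of the category of Weil algebras: iterated tensor products of the algebras
`Wⁿ = ℕ[x₁, …, xₙ] / (xᵢ xⱼ)` and of `ℕ`. The algebra itself is `Weil.alg`. -/
inductive Weil : Type
  | unit : Weil
  | pow (n : ℕ) : Weil
  | tensor (A B : Weil) : Weil

noncomputable section

namespace Weil

/-- The commutative `ℕ`-algebra named by an object; `Wⁿ` is the square-zero extension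
`ℕ ⊕ ℕⁿ`, whose generators `x₁, …, xₙ` are the standard basis of `ℕⁿ`. -/
def alg : Weil → CommSemiRingCat.{0}
  | unit => CommSemiRingCat.of ℕ
  | pow n => CommSemiRingCat.of (TrivSqZeroExt ℕ (Fin n → ℕ))
  | tensor A B => CommSemiRingCat.of (A.alg ⊗[ℕ] B.alg)

/-- Morphisms are all homomorphisms of unital commutative `ℕ`-algebras (equivalently, unital
semiring homomorphisms). -/
@[ext]
structure Hom (A B : Weil) : Type where
  hom : A.alg →+* B.alg

instance : Category Weil where
  Hom := Hom
  id A := ⟨RingHom.id _⟩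
  comp f g := ⟨g.hom.comp f.hom⟩

@[ext] lemma hom_ext {A B : Weil} {f g : A ⟶ B} (h : f.hom = g.hom) : f = g := Hom.ext h

@[simp] lemma comp_hom {A B C : Weil} (f : A ⟶ B) (g : B ⟶ C) : (f ≫ g).hom = g.hom.comp f.hom := rfl
@[simp] lemma id_hom {A : Weil} : Hom.hom (𝟙 A) = RingHom.id _ := rfl

/-- An isomorphism of algebras as an isomorphism in `Weil`. -/
def isoMk {A B : Weil} (e : A.alg ≃+* B.alg) : A ≅ B where
  hom := ⟨e.toRingHom⟩
  inv := ⟨e.symm.toRingHom⟩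
  hom_inv_id := by ext; simp
  inv_hom_id := by ext; simp

/-- The tensor product of two homomorphisms. -/
def tensorMap {A B C D : Weil} (f : A.alg →+* B.alg) (g : C.alg →+* D.alg) :
   (tensor A C).alg →+* (tensor B D).alg :=
  (Algebra.TensorProduct.map f.toNatAlgHom g.toNatAlgHom).toRingHom

lemma tensor_hom_ext {A B C : Weil} {f g : (tensor A B).alg →+* C.alg}
  (h : ∀ (a : A.alg) (b : B.alg), f (a ⊗ₜ[ℕ] b : A.alg ⊗[ℕ] B.alg) = g (a ⊗ₜ[ℕ] b : A.alg ⊗[ℕ] B.alg)) : f = g := by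
  refine RingHom.ext fun x => ?_
  induction x using TensorProduct.induction_on with
  | zero => exact (map_zero f).trans (map_zero g).symm
  | tmul a b => exact h a b
  | add x y hx hy => exact (map_add f x y).trans ((congrArg₂ _ hx hy).trans (map_add g x y).symm)

/-- The monoidal structure is the tensor product over `ℕ`. -/
instance : MonoidalCategoryStruct Weil where
  tensorObj := tensor
  tensorUnit := unit
  tensorHom f g := ⟨tensorMap f.hom g.hom⟩
  whiskerLeft A _ _ g := ⟨tensorMap (RingHom.id A.alg) g.hom⟩
  whiskerRight f B := ⟨tensorMap f.hom (RingHom.id B.alg)⟩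
  associator A B C := isoMk (Algebra.TensorProduct.assoc ℕ ℕ ℕ A.alg B.alg C.alg).toRingEquiv
  leftUnitor A := isoMk (Algebra.TensorProduct.lid ℕ A.alg).toRingEquiv
  rightUnitor A := isoMk (Algebra.TensorProduct.rid ℕ ℕ A.alg).toRingEquiv

lemma tensorMap_tmul {A B C D : Weil} (f : A.alg →+* B.alg) (g : C.alg →+* D.alg) (a : A.alg) (c : C.alg) :
    tensorMap f g (a ⊗ₜ[ℕ] c : A.alg ⊗[ℕ] C.alg) = (f a ⊗ₜ[ℕ] g c : B.alg ⊗[ℕ] D.alg) := rfl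

lemma tensor_hom_ext₃ {A B C D : Weil} {f g : ((A ⊗ B) ⊗ C).alg →+* D.alg}
    (h : ∀ (a : A.alg) (b : B.alg) (c : C.alg),
      f ((a ⊗ₜ[ℕ] b : A.alg ⊗[ℕ] B.alg) ⊗ₜ[ℕ] c : (A.alg ⊗[ℕ] B.alg) ⊗[ℕ] C.alg) =
      g ((a ⊗ₜ[ℕ] b : A.alg ⊗[ℕ] B.alg) ⊗ₜ[ℕ] c : (A.alg ⊗[ℕ] B.alg) ⊗[ℕ] C.alg)) : f = g := by
  refine tensor_hom_ext (A := A ⊗ B) fun x c => ?_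
  induction x using TensorProduct.induction_on with
  | zero =>
    exact (congrArg f (TensorProduct.zero_tmul _ c)).trans ((map_zero f).trans
      ((map_zero g).symm.trans (congrArg g (TensorProduct.zero_tmul _ c)).symm))
  | tmul a b => exact h a b c
  | add x y hx hy =>
    exact (congrArg f (TensorProduct.add_tmul x y c)).trans ((map_add f _ _).trans
      ((congrArg₂ _ hx hy).trans ((map_add g _ _).symm.trans
        (congrArg g (TensorProduct.add_tmul x y c)).symm)))

lemma tensor_hom_ext₄ {A B C D E : Weil} {f g : (((A ⊗ B) ⊗ C) ⊗ D).alg →+* E.alg}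
    (h : ∀ (a : A.alg) (b : B.alg) (c : C.alg) (d : D.alg),
      f (((a ⊗ₜ[ℕ] b : A.alg ⊗[ℕ] B.alg) ⊗ₜ[ℕ] c : (A.alg ⊗[ℕ] B.alg) ⊗[ℕ] C.alg) ⊗ₜ[ℕ] d :
        ((A.alg ⊗[ℕ] B.alg) ⊗[ℕ] C.alg) ⊗[ℕ] D.alg) =
      g (((a ⊗ₜ[ℕ] b : A.alg ⊗[ℕ] B.alg) ⊗ₜ[ℕ] c : (A.alg ⊗[ℕ] B.alg) ⊗[ℕ] C.alg) ⊗ₜ[ℕ] d :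
        ((A.alg ⊗[ℕ] B.alg) ⊗[ℕ] C.alg) ⊗[ℕ] D.alg)) : f = g := by
  refine tensor_hom_ext₃ (A := A ⊗ B) fun x c d => ?_
  induction x using TensorProduct.induction_on with
  | zero =>
    have e := (congrArg (fun z => z ⊗ₜ[ℕ] d) (TensorProduct.zero_tmul (A.alg ⊗[ℕ] B.alg) c)).trans
      (TensorProduct.zero_tmul ((A.alg ⊗[ℕ] B.alg) ⊗[ℕ] C.alg) d)
    exact (congrArg f e).trans ((map_zero f).trans ((map_zero g).symm.trans (congrArg g e).symm))
  | tmul a b => exact h a b c d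
  | add x y hx hy =>
    have e := (congrArg (fun z => z ⊗ₜ[ℕ] d) (TensorProduct.add_tmul x y c)).trans
      (TensorProduct.add_tmul (x ⊗ₜ[ℕ] c) (y ⊗ₜ[ℕ] c) d)
    exact (congrArg f e).trans ((map_add f _ _).trans ((congrArg₂ _ hx hy).trans
      ((map_add g _ _).symm.trans (congrArg g e).symm)))

instance : MonoidalCategory Weil where
  tensorHom_def _ _ := hom_ext (tensor_hom_ext fun _ _ => rfl)
  id_tensorHom_id _ _ := hom_ext (tensor_hom_ext fun _ _ => rfl)
  tensorHom_comp_tensorHom _ _ _ _ := hom_ext (tensor_hom_ext fun _ _ => rfl)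
  whiskerLeft_id _ _ := hom_ext (tensor_hom_ext fun _ _ => rfl)
  id_whiskerRight _ _ := hom_ext (tensor_hom_ext fun _ _ => rfl)
  associator_naturality _ _ _ := hom_ext (tensor_hom_ext₃ fun _ _ _ => rfl)
  leftUnitor_naturality f := hom_ext (tensor_hom_ext fun n b =>
    (map_nsmul f.hom (show ℕ from n) b).symm)
  rightUnitor_naturality f := hom_ext (tensor_hom_ext fun b n =>
    (map_nsmul f.hom (show ℕ from n) b).symm)
  pentagon _ _ _ _ := hom_ext (tensor_hom_ext₄ fun _ _ _ _ => rfl)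
  triangle _ _ := hom_ext (tensor_hom_ext₃ fun a n b =>
    (TensorProduct.smul_tmul (show ℕ from n) a b).symm)

/-- The monomials of the algebra: `1` for `ℕ`; `1` (as `none`) and `xᵢ` (as `some i`) for `Wⁿ`;
products of monomials for a tensor product. -/
def Mon : Weil → Type
  | unit => Unit
  | pow n => Option (Fin n)
  | tensor A B => A.Mon × B.Mon

instance instFintypeMon : (A : Weil) → Fintype A.Mon
  | unit => inferInstanceAs (Fintype Unit)
  | pow n => inferInstanceAs (Fintype (Option (Fin n)))
  | tensor A B => 
    letI := instFintypeMon A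
    letI := instFintypeMon B
    inferInstanceAs (Fintype (A.Mon × B.Mon))

instance instDecidableEqMon : (A : Weil) → DecidableEq A.Mon
  | unit => inferInstanceAs (DecidableEq Unit)
  | pow n => inferInstanceAs (DecidableEq (Option (Fin n)))
  | tensor A B => 
    letI := instDecidableEqMon A
    letI := instDecidableEqMon B
    inferInstanceAs (DecidableEq (A.Mon × B.Mon))

/-- Coordinates on `Wⁿ`: the constant term and the coefficients of the `xᵢ`. -/
def powCoord (n : ℕ) : TrivSqZeroExt ℕ (Fin n → ℕ) ≃ₗ[ℕ] (Option (Fin n) → ℕ) where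
  toFun a o := o.elim a.fst a.snd
  invFun c := (c none, fun i => c (some i))
  map_add' a b := by ext o; cases o <;> rfl
  map_smul' r a := by ext o; cases o <;> simp 
  left_inv a := rfl
  right_inv c := by ext o; cases o <;> rfl

/-- The monomial basis. -/
def basis : (A : Weil) → Module.Basis A.Mon ℕ A.alg
  | unit => Module.Basis.singleton Unit ℕ
  | pow n => Module.Basis.ofEquivFun (powCoord n)
  | tensor A B => (A.basis).tensorProduct B.basis

/-- The elementary tensor `a ⊗ b` as an element of the algebra of `A ⊗ B`. -/
def tmul {A B : Weil} (a : A.alg) (b : B.alg) : (A ⊗ B).alg := (a ⊗ₜ[ℕ] b : A.alg ⊗[ℕ] B.alg)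

/-- The product of two monomials. -/
def Mon.pair {A B : Weil} (a : A.Mon) (b : B.Mon) : (A ⊗ B).Mon := (a, b)

/-- The underlying `ℕ`-linear map of a morphism. -/
def lin {A B : Weil} (f : A ⟶ B) : A.alg →ₗ[ℕ] B.alg := f.hom.toAddMonoidHom.toNatLinearMap

/-- The matrix of a morphism of Weil algebras in the monomial bases. -/
def mat {A B : Weil} (f : A ⟶ B) : Matrix B.Mon A.Mon ℕ :=
  LinearMap.toMatrix A.basis B.basis (lin f)

lemma mat_apply {A B : Weil} (f : A ⟶ B) (b : B.Mon) (a : A.Mon) :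
    mat f b a = B.basis.repr (f.hom (A.basis a)) b := by
  simp only [mat, LinearMap.toMatrix_apply]; rfl

lemma mat_id (A : Weil) : mat (𝟙 A) = 1 :=
  LinearMap.toMatrix_id A.basis

lemma mat_comp {A B C : Weil} (f : A ⟶ B) (g : B ⟶ C) : mat (f ≫ g) = mat g * mat f :=
  LinearMap.toMatrix_comp A.basis B.basis C.basis (lin g) (lin f)

lemma basis_pair {A B : Weil} (a : A.Mon) (b : B.Mon) :
    (A ⊗ B).basis (a.pair b) = tmul (A.basis a) (B.basis b) :=
  Module.Basis.tensorProduct_apply A.basis B.basis a b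

lemma repr_tmul {A B : Weil} (x : A.alg) (y : B.alg) (a : A.Mon) (b : B.Mon) :
    (A ⊗ B).basis.repr (tmul x y) (a.pair b) = A.basis.repr x a * B.basis.repr y b :=
  (Module.Basis.tensorProduct_repr_tmul_apply A.basis B.basis x y a b).trans (mul_comm _ _)

lemma mat_tensorHom {A B C D : Weil} (f : A ⟶ B) (g : C ⟶ D) (a : A.Mon) (b : B.Mon) (c : C.Mon)
    (d : D.Mon) : mat (f ⊗ₘ g) (b.pair d) (a.pair c) = mat f b a * mat g d c := by
  rw [mat_apply, basis_pair, mat_apply, mat_apply]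
  exact repr_tmul _ _ _ _

lemma repr_basis (A : Weil) (a a' : A.Mon) :
    A.basis.repr (A.basis a) a' = if a' = a then 1 else 0 := by
  rw [Module.Basis.repr_self, Finsupp.single_apply]; simp only [eq_comm]

lemma mat_associator {A B C : Weil} (a a' : A.Mon) (b b' : B.Mon) (c c' : C.Mon) :
    mat (α_ A B C).hom (a'.pair (b'.pair c')) ((a.pair b).pair c)
      = (if a' = a then 1 else 0) * ((if b' = b then 1 else 0) * if c' = c then 1 else 0) := by
  rw [mat_apply, basis_pair, basis_pair]
  refine (repr_tmul (B := B ⊗ C) (A.basis a) (tmul (B.basis b) (C.basis c)) _ _).trans ?_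
  rw [repr_tmul, repr_basis, repr_basis, repr_basis]

lemma mat_leftUnitor {A : Weil} (u : (𝟙_ Weil).Mon) (a a' : A.Mon) :
    mat (λ_ A).hom a' (u.pair a) = if a' = a then 1 else 0 := by
  rw [mat_apply, basis_pair, ← repr_basis]
  have : (λ_ A).hom.hom (tmul ((𝟙_ Weil).basis u) (A.basis a)) = A.basis a :=
    (congrArg (fun n : ℕ => n • A.basis a) (Module.Basis.singleton_apply Unit ℕ u)).trans (one_smul _ _)
  rw [this]

lemma mat_rightUnitor {A : Weil} (u : (𝟙_ Weil).Mon) (a a' : A.Mon) :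
    mat (ρ_ A).hom a' (a.pair u) = if a' = a then 1 else 0 := by
  rw [mat_apply, basis_pair, ← repr_basis]
  have : (ρ_ A).hom.hom (tmul (A.basis a) ((𝟙_ Weil).basis u)) = A.basis a :=
    (congrArg (fun n : ℕ => n • A.basis a) (Module.Basis.singleton_apply Unit ℕ u)).trans (one_smul _ _)
  rw [this]

/-! ### Generating morphisms of Weil algebras -/

/-- The dual numbers `W = ℕ[x] / (x²)`. -/
abbrev W : Weil := pow 1

/-- The generator `xᵢ` of `Wⁿ`. -/
def var {n : ℕ} (i : Fin n) : (pow n).alg :=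
  (TrivSqZeroExt.inr (Pi.single i 1) : TrivSqZeroExt ℕ (Fin n → ℕ))

/-- The algebra homomorphism out of `Wⁿ` with `xᵢ ↦ aᵢ`. -/
def descAlg {n : ℕ} {B : Weil} (a : Fin n → B.alg) (ha : ∀ i j, a i * a j = 0) :
    TrivSqZeroExt ℕ (Fin n → ℕ) →ₐ[ℕ] B.alg :=
  TrivSqZeroExt.lift (Algebra.ofId ℕ B.alg) (Fintype.linearCombination ℕ a)
    (fun x y => by
      simp only [Fintype.linearCombination_apply, Finset.sum_mul_sum, smul_mul_smul_comm, ha,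
        smul_zero, Finset.sum_const_zero])
    (fun r x => by rw [map_smul, Algebra.ofId_apply, Algebra.smul_def])
    (fun r x => by
      rw [Algebra.ofId_apply, ← Algebra.commutes, ← Algebra.smul_def, ← map_smul]
      exact congrArg _ (funext fun i => mul_comm (x i) r))

/-- The morphism out of `Wⁿ` with `xᵢ ↦ aᵢ`. -/
def desc {n : ℕ} {B : Weil} (a : Fin n → B.alg) (ha : ∀ i j, a i * a j = 0) : pow n ⟶ B :=
  ⟨(descAlg a ha).toRingHom⟩

lemma desc_var {n : ℕ} {B : Weil} (a : Fin n → B.alg) (ha : ∀ i j, a i * a j = 0) (i : Fin n) :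
    (desc a ha).hom (var i) = a i := by
  change descAlg a ha (TrivSqZeroExt.inr (Pi.single i 1)) = a i
  rw [descAlg, TrivSqZeroExt.lift_apply_inr, Fintype.linearCombination_apply_single, one_smul]

lemma var_mul_var {n : ℕ} (i j : Fin n) : var i * var j = 0 :=
  TrivSqZeroExt.inr_mul_inr ℕ _ _

lemma hom_ext_var {n : ℕ} {B : Weil} {f g : pow n ⟶ B} (h : ∀ i, f.hom (var i) = g.hom (var i)) :
    f = g := by
  have key : lin f = lin g := (pow n).basis.ext fun o => by
    have e : (pow n).basis o = (powCoord n).symm (Pi.single o 1) :=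
      congrFun (Module.Basis.coe_ofEquivFun (powCoord n)) o
    cases o with
    | none =>
      have e' : (pow n).basis none = 1 := by
        refine e.trans ((LinearEquiv.symm_apply_eq (powCoord n)).2 (funext fun o => ?_))
        change _ = Option.elim o (TrivSqZeroExt.fst (1 : TrivSqZeroExt ℕ (Fin n → ℕ)))
          (TrivSqZeroExt.snd (1 : TrivSqZeroExt ℕ (Fin n → ℕ)))
        cases o <;> simp
      rw [e']
      exact (map_one f.hom).trans (map_one g.hom).symm
    | some i =>
      have e' : (pow n).basis (some i) = var i := by
        refine e.trans ((LinearEquiv.symm_apply_eq (powCoord n)).2 (funext fun o => ?_))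
        change _ = Option.elim o
          (TrivSqZeroExt.fst (TrivSqZeroExt.inr (Pi.single i 1) : TrivSqZeroExt ℕ (Fin n → ℕ)))
          (TrivSqZeroExt.snd (TrivSqZeroExt.inr (Pi.single i 1) : TrivSqZeroExt ℕ (Fin n → ℕ)))
        cases o <;> simp [Pi.single_apply]
      rw [e']
      exact h i
  exact hom_ext (RingHom.ext fun x => LinearMap.congr_fun key x)

lemma hom_ext_unit {B : Weil} {f g : 𝟙_ Weil ⟶ B} : f = g :=
  hom_ext (Subsingleton.elim (α := ℕ →+* B.alg) f.hom g.hom)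

/-- The augmentation `Wⁿ ⟶ ℕ`, `xᵢ ↦ 0`; for `n = 1` this is `p`. -/
def aug (n : ℕ) : pow n ⟶ 𝟙_ Weil := desc (fun _ => 0) fun _ _ => zero_mul _

/-- The unit `ℕ ⟶ A`; for `A = W` this is `0`. -/
def const (A : Weil) : 𝟙_ Weil ⟶ A := ⟨Nat.castRingHom A.alg⟩

/-- The product projection `Wⁿ ⟶ W`, `xᵢ ↦ x`, the other generators `↦ 0`. -/
def proj {n : ℕ} (i : Fin n) : pow n ⟶ W := desc (fun j => if j = i then var 0 else 0) fun j k => by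
  split_ifs <;> simp [var_mul_var]

/-- The addition `W² ⟶ W`, both generators `↦ x`. -/
def plus : pow 2 ⟶ W := desc (fun _ => var 0) fun _ _ => var_mul_var _ _

lemma tmul_mul_tmul {A B : Weil} (a a' : A.alg) (b b' : B.alg) :
    tmul a b * tmul a' b' = tmul (a * a') (b * b') :=
  Algebra.TensorProduct.tmul_mul_tmul a a' b b'

lemma tmul_zero {A B : Weil} (a : A.alg) : tmul a (0 : B.alg) = 0 := TensorProduct.tmul_zero _ _
lemma zero_tmul {A B : Weil} (b : B.alg) : tmul (0 : A.alg) b = 0 := TensorProduct.zero_tmul _ _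

/-- The vertical lift `W ⟶ W ⊗ W`, `x ↦ x ⊗ x`. -/
def ell : W ⟶ W ⊗ W := desc (fun _ => tmul (var 0) (var 0)) fun _ _ => by
  rw [tmul_mul_tmul, var_mul_var, tmul_zero]

/-- The morphism `ν : W² ⟶ W ⊗ W`, `x₁ ↦ x ⊗ x`, `x₂ ↦ 1 ⊗ x`. -/
def nu : pow 2 ⟶ W ⊗ W := desc ![tmul (var 0) (var 0), tmul 1 (var 0)] fun i j => by
  fin_cases i <;> fin_cases j <;> simp [tmul_mul_tmul, var_mul_var, tmul_zero]

end Weil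

/-! ### The category `ℕ^•` and its tangent structure -/

/-- Objects of the category `ℕ^•`; the object of dimension `k` is `ℕᵏ`. -/
@[ext]
structure NBullet : Type where
  dim : ℕ

namespace NBullet

/-- A morphism `ℕ^m ⟶ ℕ^n` is an `n × m` matrix. -/
@[ext]
structure Hom (m n : NBullet) : Type where
  mat : Matrix (Fin n.dim) (Fin m.dim) ℕ

instance : Category NBullet where
  Hom := Hom
  id _ := ⟨1⟩
  comp f g := ⟨g.mat * f.mat⟩
  id_comp f := Hom.ext (Matrix.mul_one f.mat)
  comp_id f := Hom.ext (Matrix.one_mul f.mat)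
  assoc f g h := Hom.ext (Matrix.mul_assoc h.mat g.mat f.mat).symm

lemma hom_ext {m n : NBullet} {f g : m ⟶ n} (h : ∀ i j, f.mat i j = g.mat i j) : f = g :=
  Hom.ext (Matrix.ext h)

lemma comp_mat {k m n : NBullet} (f : k ⟶ m) (g : m ⟶ n) (i : Fin n.dim) (j : Fin k.dim) :
    (f ≫ g).mat i j = ∑ l, g.mat i l * f.mat l j := rfl

lemma id_mat (m : NBullet) (i j : Fin m.dim) : Hom.mat (𝟙 m) i j = if i = j then 1 else 0 :=
  Matrix.one_apply

/-- The action on objects: `D_A (ℕᵏ) = A ⊗ ℕᵏ`, written as a power of `ℕ`. In particular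
`D_W (ℕᵏ) = ℕᵏ × ℕᵏ` and `D_{Wⁿ} (ℕᵏ) = (ℕᵏ)ⁿ⁺¹`. -/
def act : Weil → NBullet → NBullet
  | .unit, k => k
  | .pow n, k => ⟨(n + 1) * k.dim⟩
  | .tensor A B, k => act A (act B k)

/-- The coordinates of `D_A (ℕᵏ)` are indexed by a monomial of `A` and a coordinate of `ℕᵏ`;
the coordinates belonging to one monomial form a block `ℕᵏ`, the block of `1` being the first. -/
def index : (A : Weil) → (k : NBullet) → A.Mon × Fin k.dim ≃ Fin (act A k).dim
  | .unit, k => Equiv.punitProd (Fin k.dim)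
  | .pow n, _ => (Equiv.prodCongr (finSuccEquiv n).symm (Equiv.refl _)).trans finProdFinEquiv
  | .tensor A B, k => ((Equiv.prodAssoc _ _ _).trans
      (Equiv.prodCongr (Equiv.refl _) (index B k))).trans (index A (act B k))

/-- The action on morphisms: the Kronecker product `f ⊗ g`. -/
def actMap {A B : Weil} {k l : NBullet} (f : A ⟶ B) (g : k ⟶ l) : act A k ⟶ act B l where
  mat i j := Weil.mat f ((index B l).symm i).1 ((index A k).symm j).1 *
    g.mat ((index B l).symm i).2 ((index A k).symm j).2

lemma hom_ext_index {A B : Weil} {k l : NBullet} {f g : act A k ⟶ act B l}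
    (h : ∀ b y a x, f.mat (index B l (b, y)) (index A k (a, x)) =
      g.mat (index B l (b, y)) (index A k (a, x))) : f = g := by
  refine hom_ext fun i j => ?_
  have := h ((index B l).symm i).1 ((index B l).symm i).2
    ((index A k).symm j).1 ((index A k).symm j).2
  simpa only [Prod.mk.eta, Equiv.apply_symm_apply] using this

lemma actMap_mat {A B : Weil} {k l : NBullet} (f : A ⟶ B) (g : k ⟶ l) (b : B.Mon) (y : Fin l.dim)
    (a : A.Mon) (x : Fin k.dim) :
    (actMap f g).mat (index B l (b, y)) (index A k (a, x)) = Weil.mat f b a * g.mat y x := by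
  simp only [actMap, Equiv.symm_apply_apply]

lemma id_mat_index (A : Weil) (k : NBullet) (a b : A.Mon) (x y : Fin k.dim) :
    Hom.mat (𝟙 (act A k)) (index A k (b, y)) (index A k (a, x)) =
      (if b = a then 1 else 0) * if y = x then 1 else 0 := by
  rw [id_mat]
  simp only [(index A k).apply_eq_iff_eq, Prod.mk.injEq]
  split_ifs <;> simp_all

lemma actMap_id (A : Weil) (k : NBullet) : actMap (𝟙 A) (𝟙 k) = 𝟙 (act A k) :=
  hom_ext_index fun b y a x => by
    rw [actMap_mat, id_mat_index, id_mat, Weil.mat_id, Matrix.one_apply]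

lemma actMap_comp {A B C : Weil} {k l m : NBullet} (f : A ⟶ B) (f' : B ⟶ C) (g : k ⟶ l)
    (g' : l ⟶ m) : actMap (f ≫ f') (g ≫ g') = actMap f g ≫ actMap f' g' :=
  hom_ext_index fun c z a x => by
    rw [actMap_mat, comp_mat, comp_mat, Weil.mat_comp, Matrix.mul_apply, Finset.sum_mul_sum,
      ← (index B l).sum_comp, Fintype.sum_prod_type]
    refine Finset.sum_congr rfl fun b _ => Finset.sum_congr rfl fun y _ => ?_
    rw [actMap_mat, actMap_mat]; ring

lemma index_pair (A B : Weil) (k : NBullet) (a : A.Mon) (b : B.Mon) (x : Fin k.dim) :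
    index (A ⊗ B) k (a.pair b, x) = index A (act B k) (a, index B k (b, x)) := rfl

lemma actMap_tensorHom {A B C D : Weil} {k l : NBullet} (f : A ⟶ B) (g : C ⟶ D) (h : k ⟶ l) :
    actMap (f ⊗ₘ g) h = actMap f (actMap g h) :=
  hom_ext_index (A := A ⊗ C) (B := B ⊗ D) fun c y a x => by
    obtain ⟨c, d⟩ := c
    obtain ⟨a, b⟩ := a
    refine (actMap_mat (A := A ⊗ C) (B := B ⊗ D) (f ⊗ₘ g) h _ _ _ _).trans ?_
    refine (congrArg (· * h.mat y x) (Weil.mat_tensorHom f g a c b d)).trans ?_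
    refine Eq.trans ?_ (actMap_mat f (actMap g h) c (index D l (d, y)) a (index C k (b, x))).symm
    rw [actMap_mat, mul_assoc]

lemma actMap_unit {k l : NBullet} (g : k ⟶ l) : actMap (𝟙 Weil.unit) g = g :=
  hom_ext_index (A := .unit) (B := .unit) fun b y a x => by
    have hb : b = a := Subsingleton.elim (α := Unit) b a
    subst hb
    rw [actMap_mat, Weil.mat_id, Matrix.one_apply_eq, one_mul]
    rfl

lemma actMap_associator (A B C : Weil) (k : NBullet) :
    actMap (α_ A B C).hom (𝟙 k) = 𝟙 (act A (act B (act C k))) :=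
  hom_ext_index (A := (A ⊗ B) ⊗ C) (B := A ⊗ (B ⊗ C)) fun c y a x => by
    obtain ⟨a', b', c'⟩ := c
    obtain ⟨⟨a, b⟩, c⟩ := a
    refine (actMap_mat (α_ A B C).hom (𝟙 k) _ _ _ _).trans ?_
    refine (congrArg (· * _) (Weil.mat_associator a a' b b' c c')).trans ?_
    refine Eq.trans ?_ (id_mat_index A _ a a' (index B _ (b, index C k (c, x)))
      (index B _ (b', index C k (c', y)))).symm
    rw [id_mat]
    simp only [(index B (act C k)).apply_eq_iff_eq, (index C k).apply_eq_iff_eq, Prod.mk.injEq]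
    split_ifs <;> simp_all

lemma actMap_leftUnitor (A : Weil) (k : NBullet) :
    actMap (λ_ A).hom (𝟙 k) = 𝟙 (act A k) :=
  hom_ext_index (A := 𝟙_ Weil ⊗ A) fun a' y a x => by
    obtain ⟨u, a⟩ := a
    refine (actMap_mat (λ_ A).hom (𝟙 k) _ _ _ _).trans ?_
    refine (congrArg (· * _) (Weil.mat_leftUnitor u a a')).trans ?_
    rw [id_mat]
    exact (id_mat_index A k a a' x y).symm

lemma actMap_rightUnitor (A : Weil) (k : NBullet) :
    actMap (ρ_ A).hom (𝟙 k) = 𝟙 (act A k) :=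
  hom_ext_index (A := A ⊗ 𝟙_ Weil) fun a' y a x => by
    obtain ⟨a, u⟩ := a
    refine (actMap_mat (ρ_ A).hom (𝟙 k) _ _ _ _).trans ?_
    refine (congrArg (· * _) (Weil.mat_rightUnitor u a a')).trans ?_
    rw [id_mat]
    exact (id_mat_index A k a a' x y).symm

open MonoidalLeftAction

/-- The actegory `(ℕ^•, D)`. -/
instance : MonoidalLeftAction Weil NBullet where
  actionObj := act
  actionHomLeft f k := actMap f (𝟙 k)
  actionHomRight A _ _ g := actMap (𝟙 A) g
  actionHom := actMap
  actionAssocIso A B k := Iso.refl (act A (act B k))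
  actionUnitIso k := Iso.refl k
  actionHom_def f g := by rw [← actMap_comp, Category.comp_id, Category.id_comp]
  actionHomRight_id := actMap_id
  id_actionHomLeft := actMap_id
  actionHom_comp := actMap_comp
  actionAssocIso_hom_naturality f g h :=
    (Category.comp_id _).trans ((actMap_tensorHom f g h).trans (Category.id_comp _).symm)
  actionUnitIso_hom_naturality f :=
    (Category.id_comp _).trans ((actMap_unit f).symm.trans (Category.comp_id _).symm)
  whiskerLeft_actionHomLeft A _ _ f k :=
    (actMap_tensorHom (𝟙 A) f (𝟙 k)).trans ((Category.comp_id _).symm.trans (Category.id_comp _).symm)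
  whiskerRight_actionHomLeft B f k := by
    refine (actMap_tensorHom f (𝟙 B) (𝟙 k)).trans ?_
    rw [actMap_id]
    exact ((Category.comp_id _).symm.trans (Category.id_comp _).symm)
  associator_actionHom A B C k := by
    rw [actMap_associator]
    change 𝟙 _ ≫ 𝟙 _ ≫ actMap (𝟙 A) (𝟙 _) = 𝟙 _ ≫ 𝟙 _
    rw [actMap_id]
    simp only [Category.id_comp]
  leftUnitor_actionHom A k := (actMap_leftUnitor A k).trans (Category.id_comp _).symm
  rightUnitor_actionHom A k := by
    refine (actMap_rightUnitor A k).trans ?_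
    change 𝟙 _ = 𝟙 _ ≫ actMap (𝟙 A) (𝟙 k)
    rw [actMap_id]
    exact (Category.id_comp _).symm

end NBullet

section

open CategoryTheory.Limits MonoidalLeftAction

/-! ### Pullback powers -/

section PullbackPower

variable {X : Type u} [Category.{v} X]

/-- `P`, with structure map `b` and projections `πᵢ`, is an `n`-th pullback power of `q` over `M`.
For `n = 0` this says that `b` is an isomorphism. -/
structure IsPullbackPower {E M P : X} (q : E ⟶ M) {n : ℕ} (b : P ⟶ M) (π : Fin n → (P ⟶ E)) :
    Prop where
  w : ∀ i, π i ≫ q = b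
  isLimit : Nonempty (IsLimit (WidePullbackCone.mk (f := fun _ : Fin n => q) b π w))

namespace IsPullbackPower

variable {E M P : X} {q : E ⟶ M} {n : ℕ} {b : P ⟶ M} {π : Fin n → (P ⟶ E)}

/-- The morphism into a pullback power with given components. -/
def lift (h : IsPullbackPower q b π) {Z : X} (c : Z ⟶ M) (f : Fin n → (Z ⟶ E))
    (hf : ∀ i, f i ≫ q = c) : Z ⟶ P :=
  WidePullbackCone.IsLimit.lift h.isLimit.some c f hf

lemma lift_base (h : IsPullbackPower q b π) {Z : X} (c : Z ⟶ M) (f : Fin n → (Z ⟶ E))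
    (hf : ∀ i, f i ≫ q = c) : h.lift c f hf ≫ b = c :=
  WidePullbackCone.IsLimit.lift_base h.isLimit.some c f hf

lemma lift_π (h : IsPullbackPower q b π) {Z : X} (c : Z ⟶ M) (f : Fin n → (Z ⟶ E))
    (hf : ∀ i, f i ≫ q = c) (i : Fin n) : h.lift c f hf ≫ π i = f i :=
  WidePullbackCone.IsLimit.lift_π h.isLimit.some c f hf i

lemma hom_ext (h : IsPullbackPower q b π) {Z : X} {f g : Z ⟶ P} (hb : f ≫ b = g ≫ b)
    (hπ : ∀ i, f ≫ π i = g ≫ π i) : f = g :=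
  WidePullbackCone.IsLimit.hom_ext h.isLimit.some hb hπ

lemma of_lift (w : ∀ i, π i ≫ q = b)
    (l : ∀ {Z : X} (c : Z ⟶ M) (f : Fin n → (Z ⟶ E)), (∀ i, f i ≫ q = c) →
      ∃ u : Z ⟶ P, u ≫ b = c ∧ ∀ i, u ≫ π i = f i)
    (e : ∀ {Z : X} (f g : Z ⟶ P), f ≫ b = g ≫ b → (∀ i, f ≫ π i = g ≫ π i) → f = g) :
    IsPullbackPower q b π where
  w := w
  isLimit := ⟨WidePullbackCone.IsLimit.mk _
    (fun t => (l t.base t.π t.condition).choose)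
    (fun t => (l t.base t.π t.condition).choose_spec.1)
    (fun t => (l t.base t.π t.condition).choose_spec.2)
    (fun t m hb hπ => e m _ (hb.trans (l t.base t.π t.condition).choose_spec.1.symm)
      fun i => (hπ i).trans ((l t.base t.π t.condition).choose_spec.2 i).symm)⟩

end IsPullbackPower

end PullbackPower

/-- A choice of all finite pullback powers of `q`. -/
structure PullbackPowers {X : Type u} [Category.{v} X] {E M : X} (q : E ⟶ M) where
  obj : ℕ → X
  base (n : ℕ) : obj n ⟶ M
  π (n : ℕ) : Fin n → (obj n ⟶ E)
  isPower (n : ℕ) : IsPullbackPower q (base n) (π n)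

/-- The data of an additive bundle: a projection with pullback powers, a zero section and an
addition. -/
structure BundleData (X : Type u) [Category.{v} X] where
  E : X
  M : X
  q : E ⟶ M
  powers : PullbackPowers q
  ζ : M ⟶ E
  σ : powers.obj 2 ⟶ E

namespace BundleData

variable {X : Type u} [Category.{v} X] (B : BundleData X)

/-- The pullback power `Eₙ`. -/
abbrev pow (n : ℕ) : X := B.powers.obj n
/-- The structure map `Eₙ ⟶ M`. -/
abbrev base (n : ℕ) : B.pow n ⟶ B.M := B.powers.base n
/-- The projections `Eₙ ⟶ E`. -/
abbrev π (n : ℕ) (i : Fin n) : B.pow n ⟶ B.E := B.powers.π n i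

lemma π_q (n : ℕ) (i : Fin n) : B.π n i ≫ B.q = B.base n := (B.powers.isPower n).w i

/-- The morphism into `Eₙ` with given components. -/
def lift {n : ℕ} {Z : X} (c : Z ⟶ B.M) (f : Fin n → (Z ⟶ B.E)) (hf : ∀ i, f i ≫ B.q = c) :
    Z ⟶ B.pow n :=
  (B.powers.isPower n).lift c f hf

lemma lift_base {n : ℕ} {Z : X} (c : Z ⟶ B.M) (f : Fin n → (Z ⟶ B.E)) (hf : ∀ i, f i ≫ B.q = c) :
    B.lift c f hf ≫ B.base n = c :=
  (B.powers.isPower n).lift_base c f hf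

lemma lift_π {n : ℕ} {Z : X} (c : Z ⟶ B.M) (f : Fin n → (Z ⟶ B.E)) (hf : ∀ i, f i ≫ B.q = c)
    (i : Fin n) : B.lift c f hf ≫ B.π n i = f i :=
  (B.powers.isPower n).lift_π c f hf i

lemma hom_ext {n : ℕ} {Z : X} {f g : Z ⟶ B.pow n} (hb : f ≫ B.base n = g ≫ B.base n)
    (hπ : ∀ i, f ≫ B.π n i = g ≫ B.π n i) : f = g :=
  (B.powers.isPower n).hom_ext hb hπ

/-- The morphism `⟨f, g⟩` into `E₂`. -/
def pair {Z : X} (f g : Z ⟶ B.E) (h : f ≫ B.q = g ≫ B.q) : Z ⟶ B.pow 2 :=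
  B.lift (f ≫ B.q) ![f, g] (Fin.forall_fin_two.2 ⟨rfl, h.symm⟩)

lemma pair_base {Z : X} (f g : Z ⟶ B.E) (h : f ≫ B.q = g ≫ B.q) :
    B.pair f g h ≫ B.base 2 = f ≫ B.q := B.lift_base _ _ _
lemma pair_fst {Z : X} (f g : Z ⟶ B.E) (h : f ≫ B.q = g ≫ B.q) :
    B.pair f g h ≫ B.π 2 0 = f := B.lift_π _ _ _ 0
lemma pair_snd {Z : X} (f g : Z ⟶ B.E) (h : f ≫ B.q = g ≫ B.q) :
    B.pair f g h ≫ B.π 2 1 = g := B.lift_π _ _ _ 1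

lemma comp_pair {Y Z : X} (k : Y ⟶ Z) (f g : Z ⟶ B.E) (h : f ≫ B.q = g ≫ B.q) :
    k ≫ B.pair f g h = B.pair (k ≫ f) (k ≫ g) (by simp only [Category.assoc, h]) := by
  refine B.hom_ext ?_ (Fin.forall_fin_two.2 ⟨?_, ?_⟩)
  · rw [Category.assoc, pair_base, pair_base, Category.assoc]
  · rw [Category.assoc, pair_fst, pair_fst]
  · rw [Category.assoc, pair_snd, pair_snd]

/-- The axioms of an additive bundle. -/
structure IsAdditive : Prop where
  σ_q : B.σ ≫ B.q = B.base 2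
  ζ_q : B.ζ ≫ B.q = 𝟙 B.M
  assoc :
    B.pair (B.pair (B.π 3 0) (B.π 3 1) (by rw [π_q, π_q]) ≫ B.σ) (B.π 3 2)
        (by rw [Category.assoc, σ_q, pair_base, π_q, π_q]) ≫ B.σ =
      B.pair (B.π 3 0) (B.pair (B.π 3 1) (B.π 3 2) (by rw [π_q, π_q]) ≫ B.σ)
        (by rw [Category.assoc, σ_q, pair_base, π_q, π_q]) ≫ B.σ
  comm : B.pair (B.π 2 1) (B.π 2 0) (by rw [π_q, π_q]) ≫ B.σ = B.σ
  unit : B.pair (B.q ≫ B.ζ) (𝟙 B.E) (by rw [Category.assoc, ζ_q, Category.comp_id,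
    Category.id_comp]) ≫ B.σ = 𝟙 B.E

/-- Additive bundle morphisms `(f, g)`. -/
structure IsAdditiveMorphism (B B' : BundleData X) (f : B.E ⟶ B'.E) (g : B.M ⟶ B'.M) : Prop where
  comm_q : f ≫ B'.q = B.q ≫ g
  comm_σ : B'.pair (B.π 2 0 ≫ f) (B.π 2 1 ≫ f)
      (by rw [Category.assoc, Category.assoc, comm_q, ← Category.assoc, ← Category.assoc, π_q, π_q])
      ≫ B'.σ = B.σ ≫ f
  comm_ζ : g ≫ B'.ζ = B.ζ ≫ f

end BundleData

section TangentActegory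

variable (X : Type u) [Category.{v} X] [MonoidalLeftAction Weil X]

/-- The functor `T_A = A ⊙ -`. -/
abbrev weilFunctor (A : Weil) : X ⥤ X := (curriedAction Weil X).obj A

/-- The iterates `Tᵏ` of the tangent functor `T = T_W`. -/
def tangentIter : ℕ → (X ⥤ X)
  | 0 => 𝟭 X
  | k + 1 => tangentIter k ⋙ weilFunctor X Weil.W

variable {X}

/-- The projection `T_n Z = T_{Wⁿ} Z ⟶ Z`; for `n = 1` this is `p`. -/
def tangentProj (n : ℕ) (Z : X) : Weil.pow n ⊙ₗ Z ⟶ Z :=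
  Weil.aug n ⊵ₗ Z ≫ (λₗ Z).hom

/-- The zero `Z ⟶ T_A Z`. -/
def weilZero (A : Weil) (Z : X) : Z ⟶ A ⊙ₗ Z :=
  (λₗ Z).inv ≫ Weil.const A ⊵ₗ Z

/-- The vertical lift `ℓ : T Z ⟶ T T Z`. -/
def tangentLift (Z : X) : Weil.W ⊙ₗ Z ⟶ Weil.W ⊙ₗ Weil.W ⊙ₗ Z :=
  Weil.ell ⊵ₗ Z ≫ (αₗ Weil.W Weil.W Z).hom

/-- The morphism `ν : T₂ Z ⟶ T T Z`. -/
def tangentNu (Z : X) : Weil.pow 2 ⊙ₗ Z ⟶ Weil.W ⊙ₗ Weil.W ⊙ₗ Z :=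
  Weil.nu ⊵ₗ Z ≫ (αₗ Weil.W Weil.W Z).hom

end TangentActegory

/-- A `Weil`-actegory is a tangent actegory if it has the tangent pullbacks: `Tᵏ T_n Z` is the
`n`-th pullback power of `Tᵏ p`, and `Tᵏ` of the universality square of the vertical lift is a
pullback. -/
class IsTangentActegory (X : Type u) [Category.{v} X] [MonoidalLeftAction Weil X] : Prop where
  foundational (k n : ℕ) (Z : X) :
    IsPullbackPower ((tangentIter X k).map (tangentProj 1 Z))
      ((tangentIter X k).map (tangentProj n Z))
      fun i : Fin n => (tangentIter X k).map (Weil.proj i ⊵ₗ Z)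
  universality (k : ℕ) (Z : X) :
    IsPullback ((tangentIter X k).map (tangentNu Z)) ((tangentIter X k).map (tangentProj 2 Z))
      ((tangentIter X k).map (Weil.W ⊴ₗ tangentProj 1 Z))
      ((tangentIter X k).map (weilZero Weil.W Z))

section Bundles

variable {X : Type u} [Category.{v} X] [MonoidalLeftAction Weil X]

/-- The additive bundle `(T Z, Z, p, 0, +)`. -/
def tangentBundle [IsTangentActegory X] (Z : X) : BundleData X where
  E := Weil.W ⊙ₗ Z
  M := Z
  q := tangentProj 1 Z
  powers := ⟨fun n => Weil.pow n ⊙ₗ Z, fun n => tangentProj n Z, fun _ i => Weil.proj i ⊵ₗ Z,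
    fun n => IsTangentActegory.foundational 0 n Z⟩
  ζ := weilZero Weil.W Z
  σ := Weil.plus ⊵ₗ Z

lemma tangentProj_naturality (n : ℕ) {Y Z : X} (f : Y ⟶ Z) :
    Weil.pow n ⊴ₗ f ≫ tangentProj n Z = tangentProj n Y ≫ f := by
  simp [tangentProj, action_exchange_assoc]

lemma weilZero_naturality (A : Weil) {Y Z : X} (f : Y ⟶ Z) :
    f ≫ weilZero A Z = weilZero A Y ≫ A ⊴ₗ f := by
  rw [weilZero, weilZero, Category.assoc, ← action_exchange, unit_actionHomRight]
  simp

lemma weilZero_map {A A' : Weil} (f : A ⟶ A') (Z : X) :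
    weilZero A Z ≫ f ⊵ₗ Z = weilZero A' Z := by
  rw [weilZero, Category.assoc, ← comp_actionHomLeft, weilZero]
  congr 2
  exact Weil.hom_ext_unit

lemma weilZero_proj (n : ℕ) (Z : X) : weilZero (Weil.pow n) Z ≫ tangentProj n Z = 𝟙 Z := by
  rw [weilZero, tangentProj, Category.assoc, ← comp_actionHomLeft_assoc]
  have : Weil.const (Weil.pow n) ≫ Weil.aug n = 𝟙 _ := Weil.hom_ext_unit
  simp [this]

namespace BundleData

variable (B : BundleData X)

/-- The pullback powers of `q` are preserved by all powers of the tangent functor. -/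
def PowersPreserved : Prop :=
  ∀ k n : ℕ, IsPullbackPower ((tangentIter X k).map B.q) ((tangentIter X k).map (B.base n))
    fun i => (tangentIter X k).map (B.π n i)

lemma PowersPreserved.one {B : BundleData X} (h : B.PowersPreserved) (n : ℕ) :
    IsPullbackPower (Weil.W ⊴ₗ B.q) (Weil.W ⊴ₗ B.base n) fun i => Weil.W ⊴ₗ B.π n i :=
  h 1 n

/-- The bundle `(T E, T M, T q, T ζ, T σ)`. -/
def tangent (h : B.PowersPreserved) : BundleData X where
  E := Weil.W ⊙ₗ B.E
  M := Weil.W ⊙ₗ B.M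
  q := Weil.W ⊴ₗ B.q
  powers := ⟨fun n => Weil.W ⊙ₗ B.pow n, fun n => Weil.W ⊴ₗ B.base n,
    fun n i => Weil.W ⊴ₗ B.π n i, h.one⟩
  ζ := Weil.W ⊴ₗ B.ζ
  σ := Weil.W ⊴ₗ B.σ

lemma lift_compat (lam : B.E ⟶ Weil.W ⊙ₗ B.E)
    (hlam : lam ≫ Weil.W ⊴ₗ B.q = B.q ≫ weilZero Weil.W B.M) (i j : Fin 2) :
    (B.π 2 i ≫ lam) ≫ Weil.W ⊴ₗ B.q = (B.π 2 j ≫ weilZero Weil.W B.E) ≫ Weil.W ⊴ₗ B.q := by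
  rw [Category.assoc, hlam, Category.assoc, ← weilZero_naturality, ← Category.assoc,
    ← Category.assoc, B.π_q, B.π_q]

variable (h : B.PowersPreserved) (lam : B.E ⟶ Weil.W ⊙ₗ B.E)
  (hlam : lam ≫ Weil.W ⊴ₗ B.q = B.q ≫ weilZero Weil.W B.M)

/-- The morphism `T σ ∘ ⟨λ ∘ π₀, 0 ∘ π₁⟩ : E₂ ⟶ T E`. -/
def liftThenZero : B.pow 2 ⟶ Weil.W ⊙ₗ B.E :=
  (B.tangent h).pair (B.π 2 0 ≫ lam) (B.π 2 1 ≫ weilZero Weil.W B.E)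
    (B.lift_compat lam hlam 0 1) ≫ Weil.W ⊴ₗ B.σ

/-- The morphism `⟨0 ∘ π₀, λ ∘ π₁⟩ : E₂ ⟶ T (E₂)`. -/
def zeroAndLift : B.pow 2 ⟶ Weil.W ⊙ₗ B.pow 2 :=
  (B.tangent h).pair (B.π 2 0 ≫ weilZero Weil.W B.E) (B.π 2 1 ≫ lam)
    (B.lift_compat lam hlam 1 0).symm

lemma zeroAndLift_fst : B.zeroAndLift h lam hlam ≫ Weil.W ⊴ₗ B.π 2 0 =
    B.π 2 0 ≫ weilZero Weil.W B.E :=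
  (B.tangent h).pair_fst _ _ _

lemma zeroAndLift_snd : B.zeroAndLift h lam hlam ≫ Weil.W ⊴ₗ B.π 2 1 = B.π 2 1 ≫ lam :=
  (B.tangent h).pair_snd _ _ _

end BundleData

/-- A differential bundle, with a choice of the pullback powers of its projection. The field `lam`
is the lift `λ`. -/
structure DifferentialBundle (X : Type u) [Category.{v} X] [MonoidalLeftAction Weil X]
    [IsTangentActegory X] extends BundleData X where
  preserved : toBundleData.PowersPreserved
  additive : toBundleData.IsAdditive
  lam : E ⟶ Weil.W ⊙ₗ E
  lam_zero : toBundleData.IsAdditiveMorphism (toBundleData.tangent preserved) lam (weilZero Weil.W M)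
  lam_ζ : toBundleData.IsAdditiveMorphism (tangentBundle E) lam ζ
  universality (k : ℕ) : IsPullback
    ((tangentIter X k).map (toBundleData.liftThenZero preserved lam lam_zero.comm_q))
    ((tangentIter X k).map (powers.base 2))
    ((tangentIter X k).map (Weil.W ⊴ₗ q))
    ((tangentIter X k).map (weilZero Weil.W M))
  lam_lam : lam ≫ tangentLift E = lam ≫ Weil.W ⊴ₗ lam

namespace DifferentialBundle

/-! #### The fibrewise commutative monoid structure -/

variable [IsTangentActegory X] (B : DifferentialBundle X)

/-- The sum `f + g = σ ∘ ⟨f, g⟩`. -/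
def sum {Z : X} (f g : Z ⟶ B.E) (h : f ≫ B.q = g ≫ B.q) : Z ⟶ B.E := B.pair f g h ≫ B.σ

lemma sum_q {Z : X} (f g : Z ⟶ B.E) (h : f ≫ B.q = g ≫ B.q) : B.sum f g h ≫ B.q = f ≫ B.q := by
  rw [sum, Category.assoc, B.additive.σ_q, B.pair_base]

lemma comp_sum {Y Z : X} (k : Y ⟶ Z) (f g : Z ⟶ B.E) (h : f ≫ B.q = g ≫ B.q) :
    k ≫ B.sum f g h = B.sum (k ≫ f) (k ≫ g) (by simp only [Category.assoc, h]) := by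
  rw [sum, ← Category.assoc, B.comp_pair]; rfl

lemma sum_comm {Z : X} (f g : Z ⟶ B.E) (h : f ≫ B.q = g ≫ B.q) :
    B.sum f g h = B.sum g f h.symm := by
  have := congrArg (B.pair g f h.symm ≫ ·) B.additive.comm
  simp only [← Category.assoc, B.comp_pair, B.pair_fst, B.pair_snd] at this
  exact this

lemma sum_assoc {Z : X} (f g k : Z ⟶ B.E) (h : f ≫ B.q = g ≫ B.q) (h' : g ≫ B.q = k ≫ B.q) :
    B.sum (B.sum f g h) k (by rw [sum_q, h, h']) =
      B.sum f (B.sum g k h') (by rw [sum_q, h]) := by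
  have := congrArg (B.lift (n := 3) (f ≫ B.q) ![f, g, k] (by
    intro i; fin_cases i
    · rfl
    · exact h.symm
    · exact (h.trans h').symm) ≫ ·) B.additive.assoc
  simp only [← Category.assoc, B.comp_pair, B.lift_π] at this
  exact this

lemma zero_sum {Z : X} (f : Z ⟶ B.E) : B.sum ((f ≫ B.q) ≫ B.ζ) f (by
    rw [Category.assoc, B.additive.ζ_q, Category.comp_id]) = f := by
  have := congrArg (f ≫ ·) B.additive.unit
  simp only [← Category.assoc, B.comp_pair, Category.comp_id] at this
  exact this

/-- The morphisms `Z ⟶ E` over `M`, where `Z` lies over `M` through `b`. -/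
def HomOver {Z : X} (b : Z ⟶ B.M) : Type v := {f : Z ⟶ B.E // f ≫ B.q = b}

instance {Z : X} (b : Z ⟶ B.M) : Add (HomOver B b) where
  add f g := ⟨B.sum f.1 g.1 (f.2.trans g.2.symm), (B.sum_q _ _ _).trans f.2⟩

instance {Z : X} (b : Z ⟶ B.M) : Zero (HomOver B b) where
  zero := ⟨b ≫ B.ζ, by rw [Category.assoc, B.additive.ζ_q, Category.comp_id]⟩

lemma zero_add_hom {Z : X} {b : Z ⟶ B.M} (f : HomOver B b) : 0 + f = f :=
  Subtype.ext (by
    obtain ⟨f, rfl⟩ := f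
    exact B.zero_sum f)

lemma add_comm_hom {Z : X} {b : Z ⟶ B.M} (f g : HomOver B b) : f + g = g + f :=
  Subtype.ext (B.sum_comm _ _ _)

instance {Z : X} (b : Z ⟶ B.M) : AddCommMonoid (HomOver B b) where
  add_assoc f g h := Subtype.ext
    (B.sum_assoc f.1 g.1 h.1 (f.2.trans g.2.symm) (g.2.trans h.2.symm))
  add_comm := B.add_comm_hom
  zero_add := B.zero_add_hom
  add_zero f := (B.add_comm_hom f 0).trans (B.zero_add_hom f)
  nsmul := nsmulRec

/-- Precomposition is additive. -/
def precomp {Y Z : X} (k : Y ⟶ Z) {b : Z ⟶ B.M} {c : Y ⟶ B.M} (h : k ≫ b = c) :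
    HomOver B b →+ HomOver B c where
  toFun f := ⟨k ≫ f.1, by rw [Category.assoc, f.2, h]⟩
  map_zero' := Subtype.ext (by
    subst h
    exact (Category.assoc _ _ _).symm)
  map_add' f g := Subtype.ext (B.comp_sum k f.1 g.1 (f.2.trans g.2.symm))

/-- The projection `πᵢ` as a morphism over `M`. -/
def proj (n : ℕ) (i : Fin n) : HomOver B (B.base n) := ⟨B.π n i, B.π_q n i⟩

/-- The linear combination `∑ⱼ Aᵢⱼ • πⱼ`. -/
def linComb {m n : ℕ} (A : Matrix (Fin n) (Fin m) ℕ) (i : Fin n) :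
    HomOver B (B.base m) :=
  ∑ j, A i j • B.proj m j

/-- The morphism `⟨∑ⱼ A₁ⱼ • πⱼ, …, ∑ⱼ Aₙⱼ • πⱼ⟩ : E_m ⟶ E_n`. -/
def matrixMap {m n : ℕ} (A : Matrix (Fin n) (Fin m) ℕ) : B.pow m ⟶ B.pow n :=
  B.lift (B.base m) (fun i => (B.linComb A i).1) fun i => (B.linComb A i).2

lemma matrixMap_base {m n : ℕ} (A : Matrix (Fin n) (Fin m) ℕ) :
    B.matrixMap A ≫ B.base n = B.base m := B.lift_base _ _ _

lemma matrixMap_π {m n : ℕ} (A : Matrix (Fin n) (Fin m) ℕ) (i : Fin n) :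
    B.matrixMap A ≫ B.π n i = (B.linComb A i).1 := B.lift_π _ _ _ i

lemma matrixMap_proj {m n : ℕ} (A : Matrix (Fin n) (Fin m) ℕ) (i : Fin n) :
    B.precomp (B.matrixMap A) (B.matrixMap_base A) (B.proj n i) = B.linComb A i :=
  Subtype.ext (B.matrixMap_π A i)

lemma matrixMap_one (n : ℕ) : B.matrixMap (1 : Matrix (Fin n) (Fin n) ℕ) = 𝟙 _ := by
  refine B.hom_ext ((B.matrixMap_base _).trans (Category.id_comp _).symm) fun i => ?_
  rw [matrixMap_π, Category.id_comp]
  have : B.linComb (1 : Matrix (Fin n) (Fin n) ℕ) i = B.proj n i := by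
    rw [linComb, Finset.sum_eq_single i]
    · rw [Matrix.one_apply_eq, one_smul]
    · intro j _ hj
      rw [Matrix.one_apply_ne hj.symm, zero_smul]
    · simp
  rw [this]; rfl

lemma matrixMap_mul {l m n : ℕ} (A : Matrix (Fin m) (Fin l) ℕ) (C : Matrix (Fin n) (Fin m) ℕ) :
    B.matrixMap (C * A) = B.matrixMap A ≫ B.matrixMap C := by
  refine B.hom_ext (by rw [Category.assoc, matrixMap_base, matrixMap_base, matrixMap_base])
    fun i => ?_
  rw [Category.assoc, matrixMap_π, matrixMap_π]
  have : B.linComb (C * A) i = B.precomp (B.matrixMap A) (B.matrixMap_base A) (B.linComb C i) := by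
    simp only [linComb, map_sum, map_nsmul, matrixMap_proj, Matrix.mul_apply, Finset.sum_smul,
      Finset.smul_sum, smul_smul]
    exact Finset.sum_comm
  rw [this]; rfl

/-- The functor `F_E : ℕ^• ⥤ X`, with `F_E (ℕᵏ) = E_k`. -/
def functor : NBullet ⥤ X where
  obj k := B.pow k.dim
  map A := B.matrixMap A.mat
  map_id k := B.matrixMap_one k.dim
  map_comp A C := B.matrixMap_mul A.mat C.mat

/-- `T_{Wⁿ} (E_l)` is the `l`-th pullback power of `T_{Wⁿ} q`. -/
lemma isPower_weil (n l : ℕ) : IsPullbackPower (Weil.pow n ⊴ₗ B.q) (Weil.pow n ⊴ₗ B.base l)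
    fun i => Weil.pow n ⊴ₗ B.π l i := by
  have fnd (Z : X) : IsPullbackPower (tangentProj 1 Z) (tangentProj n Z)
      fun j : Fin n => Weil.proj j ⊵ₗ Z := IsTangentActegory.foundational 0 n Z
  have pw : IsPullbackPower (Weil.W ⊴ₗ B.q) (Weil.W ⊴ₗ B.base l)
    fun i => Weil.W ⊴ₗ B.π l i := B.preserved 1 l
  refine .of_lift (fun i => by rw [← actionHomRight_comp, B.π_q]) ?_ ?_
  · intro Z c f hf
    have h1 : ∀ i, (f i ≫ tangentProj n B.E) ≫ B.q = c ≫ tangentProj n B.M := fun i => by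
      rw [Category.assoc, ← tangentProj_naturality, ← Category.assoc, hf]
    have h2 : ∀ (j : Fin n) i, (f i ≫ Weil.proj j ⊵ₗ B.E) ≫ Weil.W ⊴ₗ B.q =
        c ≫ Weil.proj j ⊵ₗ B.M := fun j i => by
      rw [Category.assoc, ← action_exchange, ← Category.assoc, hf]
    have h3 : ∀ j, pw.lift _ _ (h2 j) ≫ tangentProj 1 (B.pow l) = B.lift _ _ h1 := fun j => by
      refine B.hom_ext ?_ fun i => ?_
      · rw [B.lift_base, Category.assoc, ← tangentProj_naturality, ← Category.assoc, pw.lift_base,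
          Category.assoc]
        exact congrArg (c ≫ ·) ((fnd B.M).w j)
      · rw [B.lift_π, Category.assoc, ← tangentProj_naturality, ← Category.assoc, pw.lift_π,
          Category.assoc]
        exact congrArg (f i ≫ ·) ((fnd B.E).w j)
    refine ⟨(fnd (B.pow l)).lift _ _ h3, (fnd B.M).hom_ext ?_ fun j => ?_, fun i =>
      (fnd B.E).hom_ext ?_ fun j => ?_⟩
    · rw [Category.assoc, tangentProj_naturality, ← Category.assoc, (fnd _).lift_base, B.lift_base]
    · rw [Category.assoc, action_exchange, ← Category.assoc, (fnd _).lift_π, pw.lift_base]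
    · rw [Category.assoc, tangentProj_naturality, ← Category.assoc, (fnd _).lift_base, B.lift_π]
    · rw [Category.assoc, action_exchange, ← Category.assoc, (fnd _).lift_π, pw.lift_π]
  · intro Z f g hb hπ
    refine (fnd _).hom_ext (B.hom_ext ?_ fun i => ?_) fun j => pw.hom_ext ?_ fun i => ?_
    · rw [Category.assoc, Category.assoc, ← tangentProj_naturality, ← Category.assoc, hb,
        Category.assoc]
    · rw [Category.assoc, Category.assoc, ← tangentProj_naturality, ← Category.assoc, hπ,
        Category.assoc]
    · rw [Category.assoc, Category.assoc, ← action_exchange, ← Category.assoc, hb,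
        Category.assoc]
    · rw [Category.assoc, Category.assoc, ← action_exchange, ← Category.assoc, hπ,
        Category.assoc]

lemma lam_q : B.lam ≫ Weil.W ⊴ₗ B.q = B.q ≫ weilZero Weil.W B.M := B.lam_zero.comm_q

/-- `α_{W,ℕ} = T σ ∘ ⟨0 ∘ π₀, λ ∘ π₁⟩ : E₂ ⟶ T E`. -/
def alphaW : B.pow 2 ⟶ Weil.W ⊙ₗ B.E :=
  B.zeroAndLift B.preserved B.lam B.lam_q ≫ Weil.W ⊴ₗ B.σ

lemma alphaW_proj : B.alphaW ≫ tangentProj 1 B.E = B.π 2 0 := by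
  have h : (B.π 2 0) ≫ B.q = (B.π 2 1 ≫ B.q ≫ B.ζ) ≫ B.q := by
    rw [Category.assoc, Category.assoc, B.additive.ζ_q, Category.comp_id, B.π_q, B.π_q]
  have hl : B.lam ≫ tangentProj 1 B.E = B.q ≫ B.ζ := B.lam_ζ.comm_q
  have h0 := B.zeroAndLift_fst B.preserved B.lam B.lam_q
  have h1 := B.zeroAndLift_snd B.preserved B.lam B.lam_q
  have e0 : (B.zeroAndLift B.preserved B.lam B.lam_q ≫ tangentProj 1 (B.pow 2)) ≫
      B.π 2 0 = B.π 2 0 := by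
    rw [Category.assoc, ← tangentProj_naturality, ← Category.assoc, h0, Category.assoc,
      weilZero_proj, Category.comp_id]
  have e1 : (B.zeroAndLift B.preserved B.lam B.lam_q ≫ tangentProj 1 (B.pow 2)) ≫
      B.π 2 1 = B.π 2 1 ≫ B.q ≫ B.ζ := by
    rw [Category.assoc, ← tangentProj_naturality, ← Category.assoc, h1, Category.assoc, hl]
  have key : B.zeroAndLift B.preserved B.lam B.lam_q ≫ tangentProj 1 (B.pow 2) =
      B.pair (B.π 2 0) (B.π 2 1 ≫ B.q ≫ B.ζ) h := by
    refine B.hom_ext ?_ (Fin.forall_fin_two.2 ⟨?_, ?_⟩)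
    · rw [B.pair_base, ← B.π_q 2 0, ← Category.assoc, e0]
    · rw [e0, B.pair_fst]
    · rw [e1, B.pair_snd]
  rw [alphaW, Category.assoc, tangentProj_naturality, ← Category.assoc, key]
  have e2 := B.zero_sum (B.π 2 0)
  rw [B.sum_comm, sum] at e2
  refine Eq.trans ?_ e2
  congr 1
  refine B.hom_ext ?_ (Fin.forall_fin_two.2 ⟨?_, ?_⟩)
  · rw [B.pair_base, B.pair_base]
  · rw [B.pair_fst, B.pair_fst]
  · rw [B.pair_snd, B.pair_snd, ← Category.assoc, B.π_q, B.π_q]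

lemma alphaW_q : B.alphaW ≫ Weil.W ⊴ₗ B.q = B.base 2 ≫ weilZero Weil.W B.M := by
  rw [alphaW, Category.assoc, ← actionHomRight_comp, B.additive.σ_q, ← B.π_q 2 0,
    actionHomRight_comp, ← Category.assoc, B.zeroAndLift_fst, Category.assoc,
    ← weilZero_naturality, ← Category.assoc]

lemma alphaPow_aux (n : ℕ) (j : Fin n) :
    (B.pair (B.π (n + 1) 0) (B.π (n + 1) j.succ) (by rw [B.π_q, B.π_q]) ≫ B.alphaW) ≫
      tangentProj 1 B.E = B.π (n + 1) 0 := by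
  rw [Category.assoc, alphaW_proj, B.pair_fst]

/-- `α_{Wⁿ,ℕ} : E_{n+1} ⟶ T_{Wⁿ} E`, the `n`-th pullback power over `E` of `α_{W,ℕ}`; here
`E_{n+1}` is the `n`-th pullback power of `π₀ : E₂ ⟶ E`, with projections `⟨π₀, πⱼ⟩`. -/
def alphaPow (n : ℕ) : B.pow (n + 1) ⟶ Weil.pow n ⊙ₗ B.E :=
  (IsTangentActegory.foundational 0 n B.E).lift (B.π (n + 1) 0)
    (fun j => B.pair (B.π (n + 1) 0) (B.π (n + 1) j.succ) (by rw [B.π_q, B.π_q]) ≫ B.alphaW)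
    (B.alphaPow_aux n)

lemma alphaPow_proj (n : ℕ) : B.alphaPow n ≫ tangentProj n B.E = B.π (n + 1) 0 :=
  (IsTangentActegory.foundational 0 n B.E).lift_base _ _ (B.alphaPow_aux n)

lemma alphaPow_component (n : ℕ) (j : Fin n) : B.alphaPow n ≫ Weil.proj j ⊵ₗ B.E =
    B.pair (B.π (n + 1) 0) (B.π (n + 1) j.succ) (by rw [B.π_q, B.π_q]) ≫ B.alphaW :=
  (IsTangentActegory.foundational 0 n B.E).lift_π _ _ (B.alphaPow_aux n) j

lemma alphaPow_q (n : ℕ) : B.alphaPow n ≫ Weil.pow n ⊴ₗ B.q =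
    B.base (n + 1) ≫ weilZero (Weil.pow n) B.M := by
  refine (IsTangentActegory.foundational 0 n B.M).hom_ext ?_ fun j => ?_
  · change (_ ≫ _) ≫ tangentProj n B.M = (_ ≫ _) ≫ tangentProj n B.M
    rw [Category.assoc, Category.assoc, tangentProj_naturality, weilZero_proj, ← Category.assoc,
      alphaPow_proj, B.π_q, Category.comp_id]
  · change (_ ≫ _) ≫ Weil.proj j ⊵ₗ B.M = (_ ≫ _) ≫ Weil.proj j ⊵ₗ B.M
    rw [Category.assoc, Category.assoc, action_exchange, weilZero_map, ← Category.assoc,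
      alphaPow_component, Category.assoc, alphaW_q, ← Category.assoc, B.pair_base, B.π_q]

/-- The projections that exhibit `F_E (D_{Wⁿ} (ℕˡ))` as the `l`-th pullback power of `E_{n+1}`
over `M`. -/
def block (n : ℕ) (k : NBullet) (i : Fin k.dim) :
    B.pow (NBullet.act (.pow n) k).dim ⟶ B.pow (n + 1) :=
  B.lift (B.base _)
    (fun a => B.π _ (NBullet.index (.pow n) k ((finSuccEquiv n) a, i)))
    fun _ => B.π_q _ _

lemma block_alphaPow_q (n : ℕ) (k : NBullet) (i : Fin k.dim) :
    (B.block n k i ≫ B.alphaPow n) ≫ Weil.pow n ⊴ₗ B.q =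
      B.base (NBullet.act (.pow n) k).dim ≫ weilZero (Weil.pow n) B.M := by
  rw [Category.assoc, alphaPow_q, ← Category.assoc, block, B.lift_base]

/-- `α_{Wⁿ,ℕˡ} : F_E (D_{Wⁿ} (ℕˡ)) ⟶ T_{Wⁿ} (E_l)`, the `l`-th pullback power of `α_{Wⁿ,ℕ}`
over the zero `M ⟶ T_{Wⁿ} M`. For `l = 0` it is this zero. -/
def alphaPowPow (n : ℕ) (k : NBullet) :
    B.functor.obj (NBullet.act (.pow n) k) ⟶ Weil.pow n ⊙ₗ B.functor.obj k :=
  (B.isPower_weil n k.dim).lift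
    (B.base (NBullet.act (.pow n) k).dim ≫ weilZero (Weil.pow n) B.M)
    (fun i => B.block n k i ≫ B.alphaPow n) (B.block_alphaPow_q n k)

/-- The lineator: the identity for `ℕ`, a pullback power for `Wⁿ`, and
`α_{A ⊗ A'} = T_A (α_{A'}) ∘ α_{A, D_{A'}}` for a tensor product. -/
def alphaHat : (A : Weil) → (k : NBullet) →
    (B.functor.obj (A ⊙ₗ k) ⟶ A ⊙ₗ B.functor.obj k)
  | .unit, k => (λₗ (B.functor.obj k)).inv
  | .pow n, k => B.alphaPowPow n k
  | .tensor A A', k => alphaHat A (A' ⊙ₗ k) ≫ A ⊴ₗ alphaHat A' k ≫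
      (αₗ A A' (B.functor.obj k)).inv

end DifferentialBundle
end Bundles

/-! ### Lax differential functors -/

/-- An oplax `Weil`-linear functor is a lax differential functor if every `T_A ∘ F` preserves
pullbacks over terminal objects and every `α_{A,-}` is Cartesian. -/
structure IsLaxDifferential {X : Type*} [Category* X] [MonoidalLeftAction Weil X]
    {Y : Type*} [Category* Y] [MonoidalLeftAction Weil Y] (F : X ⥤ Y)
    (α : F.OplaxLeftLinear Weil) : Prop where
  preserves (A : Weil) {S P Y₁ Y₂ : X} (hS : IsTerminal S)
    {fst : P ⟶ Y₁} {snd : P ⟶ Y₂} {f : Y₁ ⟶ S} {g : Y₂ ⟶ S} (h : IsPullback fst snd f g) :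
    IsPullback (A ⊴ₗ F.map fst) (A ⊴ₗ F.map snd) (A ⊴ₗ F.map f) (A ⊴ₗ F.map g)
  cartesian (A : Weil) {Y₁ Y₂ : X} (f : Y₁ ⟶ Y₂) :
    IsPullback (α.δₗ A Y₁) (F.map (A ⊴ₗ f)) (A ⊴ₗ F.map f) (α.δₗ A Y₂)

end

end

/-! Morphisms into `E` over a fixed base morphism form a commutative monoid, and morphisms into
`E_n` over it are `n`-tuples in that monoid. Each `T_A` carries the bundle to an additive bundle
`T_A E → T_A M`, because the pullback powers of `q` survive not only under `T^k` but under every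
`T_A`. The reason is that `T_{Wⁿ}` is itself a pullback power of `p` and limits commute with limits
(`PreservesPowerAlong.comp_pow`, extended to tensor products in `PreservesPowerAlong.comp_weil`).
Everything can therefore be computed in coordinates.

The heart is an explicit formula for the lineator. Every monomial `m` of `A` gives a lift `E → T_A
E` over the zero of `T_A M` (`monLift`): the zero when `m = 1`, and otherwise `λ` followed by the
map that `x ↦ m` induces, which exists because `m² = 0`. By `alpha_π`, the `i`-th coordinate of the
lineator at `A, ℕˡ` is the sum over `m` of the `m`-th lift applied to the coordinate `(m, i)`. The
inductive step for `A ⊗ A'` amounts to multiplicativity of the lifts, `monLift_pair`, whose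
nontrivial case is `ℓ ∘ λ = T(λ) ∘ λ`.

Naturality in `ℕ^•` follows because each lift is additive. Naturality in `A` is subtler: a
homomorphism sends a monomial `m ≠ 1` to an element of square zero that is in general only a sum of
monomials. One needs that the lift along such an element is the linear combination of the lifts
along its monomials (`nil_eq_evalLift`). This rests on positivity of `ℕ`: if `(a + a')² = 0` then
`a² = aa' = a'² = 0`, so `x₁ ↦ a, x₂ ↦ a'` defines a map from `W²`, and additivity need only be
checked in `T_2 E`, a pullback of two copies of `T E`. The coherence laws of the lineator are its
definition, as the structure isomorphisms of `ℕ^•` are identities.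

For Cartesianness it suffices to compare with the base: the square from the lineator to the zero `M
→ T_A M` is a pullback, by the universality of `λ` for `W`, by coordinates for `Wⁿ`, and by pasting
for tensor products (`isPullback_alpha_base`). All naturality squares follow by cancellation.
Finally, a pullback over the terminal object of `ℕ^•` is a biproduct; its matrix identities are
carried by `T_A ∘ F_E` to identities on tuples, which give a pullback again. -/

noncomputable section

open CategoryTheory.Limits MonoidalLeftAction

/-! ### Limits that are preserved by all iterates of the tangent functor -/

section Stability

variable {X : Type u} [Category.{v} X]

/-- `P`, with structure map `b` and projections `πᵢ`, is the pullback along `r` of the `ι`-th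
pullback power of `q`. Pullback powers are the case `r = 𝟙`, pullback squares are the case in which
`ι` has one element. -/
structure IsPowerAlong {ι : Type} {E N M P : X} (q : E ⟶ M) (r : N ⟶ M) (b : P ⟶ N)
    (π : ι → (P ⟶ E)) : Prop where
  w (i : ι) : π i ≫ q = b ≫ r
  exists_lift {Z : X} (c : Z ⟶ N) (f : ι → (Z ⟶ E)) (h : ∀ i, f i ≫ q = c ≫ r) :
    ∃ u : Z ⟶ P, u ≫ b = c ∧ ∀ i, u ≫ π i = f i
  hom_ext {Z : X} {f g : Z ⟶ P} (hb : f ≫ b = g ≫ b) (hπ : ∀ i, f ≫ π i = g ≫ π i) : f = g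

/-- The image under `G` of a power along a morphism is one. -/
abbrev PreservesPowerAlong {ι : Type} {E N M P : X} (q : E ⟶ M) (r : N ⟶ M) (b : P ⟶ N)
    (π : ι → (P ⟶ E)) (G : X ⥤ X) : Prop :=
  IsPowerAlong (G.map q) (G.map r) (G.map b) fun i => G.map (π i)

namespace PreservesPowerAlong

variable {ι : Type} {E N M P : X} {q : E ⟶ M} {r : N ⟶ M} {b : P ⟶ N} {π : ι → (P ⟶ E)}

lemma of_iso {G H : X ⥤ X} (e : G ≅ H) (h : PreservesPowerAlong q r b π G) :
    PreservesPowerAlong q r b π H where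
  w i := by
    rw [← cancel_epi (e.hom.app P), ← Category.assoc, ← Category.assoc, ← e.hom.naturality,
      ← e.hom.naturality, Category.assoc, Category.assoc, ← e.hom.naturality, ← e.hom.naturality,
      ← Category.assoc, ← Category.assoc, h.w i]
  exists_lift {Z} c f hf := by
    obtain ⟨u, hb, hπ⟩ := h.exists_lift (c ≫ e.inv.app N) (fun i => f i ≫ e.inv.app E) fun i => by
      rw [Category.assoc, Category.assoc, ← e.inv.naturality, ← e.inv.naturality,
        ← Category.assoc, hf, Category.assoc]
    refine ⟨u ≫ e.hom.app P, ?_, fun i => ?_⟩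
    · rw [Category.assoc, ← e.hom.naturality, ← Category.assoc, hb, Category.assoc,
        e.inv_hom_id_app, Category.comp_id]
    · rw [Category.assoc, ← e.hom.naturality, ← Category.assoc, hπ, Category.assoc,
        e.inv_hom_id_app, Category.comp_id]
  hom_ext {Z} f g hb hπ := by
    rw [← cancel_mono (e.inv.app P)]
    refine h.hom_ext ?_ fun i => ?_
    · rw [Category.assoc, Category.assoc, ← e.inv.naturality, ← Category.assoc, hb, Category.assoc]
    · rw [Category.assoc, Category.assoc, ← e.inv.naturality, ← Category.assoc, hπ, Category.assoc]

end PreservesPowerAlong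

/-- The functor `G` is kept in the statement because `r = 𝟙` is sent to `G.map (𝟙 M)`, which is the
identity only after rewriting. -/
lemma isPullbackPower_map_iff {E M P : X} {q : E ⟶ M} {n : ℕ} {b : P ⟶ M} {π : Fin n → (P ⟶ E)}
    {G : X ⥤ X} : IsPullbackPower (G.map q) (G.map b) (fun i => G.map (π i)) ↔
      PreservesPowerAlong q (𝟙 M) b π G := by
  constructor
  · intro h
    refine ⟨fun i => by rw [h.w, G.map_id, Category.comp_id], fun c f hf => ?_, h.hom_ext⟩
    simp only [G.map_id, Category.comp_id] at hf
    exact ⟨h.lift c f hf, h.lift_base c f hf, h.lift_π c f hf⟩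
  · intro h
    refine .of_lift (fun i => by rw [h.w, G.map_id, Category.comp_id]) (fun c f hf => ?_)
      fun _ _ hb hπ => h.hom_ext hb hπ
    exact h.exists_lift c f fun i => by rw [hf, G.map_id, Category.comp_id]

lemma isPullback_iff_isPowerAlong {Y S Z P : X} {fst : P ⟶ Y} {snd : P ⟶ Z} {f : Y ⟶ S}
    {g : Z ⟶ S} : IsPullback fst snd f g ↔ IsPowerAlong f g snd fun _ : Unit => fst := by
  constructor
  · intro h
    refine ⟨fun _ => h.w, fun c k hk => ?_, fun hb hπ => h.hom_ext (hπ ()) hb⟩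
    exact ⟨h.lift (k ()) c (hk ()), h.lift_snd _ _ _, fun _ => h.lift_fst _ _ _⟩
  · intro h
    refine ⟨⟨h.w ()⟩, ⟨PullbackCone.IsLimit.mk _
      (fun s => (h.exists_lift s.snd (fun _ => s.fst) fun _ => s.condition).choose)
      (fun s => (h.exists_lift s.snd (fun _ => s.fst) fun _ => s.condition).choose_spec.2 ())
      (fun s => (h.exists_lift s.snd (fun _ => s.fst) fun _ => s.condition).choose_spec.1)
      fun s m h1 h2 => ?_⟩⟩
    have key := (h.exists_lift s.snd (fun _ => s.fst) fun _ => s.condition).choose_spec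
    exact h.hom_ext (h2.trans key.1.symm) fun i => h1.trans (key.2 i).symm

lemma isPullback_map_of_iso {Y S Z P : X} {fst : P ⟶ Y} {snd : P ⟶ Z} {f : Y ⟶ S} {g : Z ⟶ S}
    {G H : X ⥤ X} (e : G ≅ H) (h : IsPullback (G.map fst) (G.map snd) (G.map f) (G.map g)) :
    IsPullback (H.map fst) (H.map snd) (H.map f) (H.map g) :=
  isPullback_iff_isPowerAlong.2 (PreservesPowerAlong.of_iso e (isPullback_iff_isPowerAlong.1 h))

lemma isPullbackPower_map_of_iso {E M P : X} {q : E ⟶ M} {n : ℕ} {b : P ⟶ M} {π : Fin n → (P ⟶ E)}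
    {G H : X ⥤ X} (e : G ≅ H)
    (h : IsPullbackPower (G.map q) (G.map b) (fun i => G.map (π i))) :
    IsPullbackPower (H.map q) (H.map b) (fun i => H.map (π i)) :=
  isPullbackPower_map_iff.2 (.of_iso e (isPullbackPower_map_iff.1 h))

/-! ### From the powers of `T` to the action of an arbitrary Weil algebra -/

variable [MonoidalLeftAction Weil X]

/-- `tangentIter` adds each new `T` on the outside; this absorbs a `T` applied on the inside. -/
lemma weilFunctor_comp_tangentIter (k : ℕ) :
    weilFunctor X Weil.W ⋙ tangentIter X k = tangentIter X (k + 1) := by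
  induction k with
  | zero => rfl
  | succ k ih =>
    change (weilFunctor X Weil.W ⋙ tangentIter X k) ⋙ weilFunctor X Weil.W = _
    rw [ih]; rfl

lemma weilProj_naturality {n : ℕ} (j : Fin n) {Y Z : X} (f : Y ⟶ Z) :
    Weil.pow n ⊴ₗ f ≫ Weil.proj j ⊵ₗ Z = Weil.proj j ⊵ₗ Y ≫ Weil.W ⊴ₗ f :=
  action_exchange _ _

variable {ι : Type} {E N M P : X} {q : E ⟶ M} {r : N ⟶ M} {b : P ⟶ N} {π : ι → (P ⟶ E)}

/-- Limits commute with limits. A morphism into `T_n Z` is a morphism into `Z` with `n` compatible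
morphisms into `T Z`, so a cone over the image under `T_n` splits into one cone over the original
diagram and `n` cones over its image under `T`. The iterate of `T` stays outermost, because the
tangent pullbacks are assumed to be preserved only by such iterates. -/
lemma PreservesPowerAlong.comp_pow [IsTangentActegory X] {H : X ⥤ X}
    (h : ∀ k, PreservesPowerAlong q r b π (H ⋙ tangentIter X k)) (n k : ℕ) :
    PreservesPowerAlong q r b π (H ⋙ weilFunctor X (Weil.pow n) ⋙ tangentIter X k) := by
  have h1 : PreservesPowerAlong q r b π (H ⋙ weilFunctor X Weil.W ⋙ tangentIter X k) := by
    rw [weilFunctor_comp_tangentIter]; exact h (k + 1)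
  have hw : ∀ i, H.map (π i) ≫ H.map q = H.map b ≫ H.map r := (h 0).w
  have h0 := h k
  generalize hG : tangentIter X k = G at *
  replace h0 : IsPowerAlong (G.map (H.map q)) (G.map (H.map r)) (G.map (H.map b))
    fun i => G.map (H.map (π i)) := h0
  replace h1 : IsPowerAlong (G.map (Weil.W ⊴ₗ H.map q)) (G.map (Weil.W ⊴ₗ H.map r))
    (G.map (Weil.W ⊴ₗ H.map b)) fun i => G.map (Weil.W ⊴ₗ H.map (π i)) := h1
  suffices IsPowerAlong (G.map (Weil.pow n ⊴ₗ H.map q)) (G.map (Weil.pow n ⊴ₗ H.map r))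
    (G.map (Weil.pow n ⊴ₗ H.map b)) fun i => G.map (Weil.pow n ⊴ₗ H.map (π i)) from this
  have fnd (Z : X) : IsPullbackPower (G.map (tangentProj 1 Z)) (G.map (tangentProj n Z))
      fun j : Fin n => G.map (Weil.proj j ⊵ₗ Z) := by
    rw [← hG]; exact IsTangentActegory.foundational k n Z
  have np (m : ℕ) {Y Z : X} (f : Y ⟶ Z) : G.map (Weil.pow m ⊴ₗ f) ≫ G.map (tangentProj m Z) =
      G.map (tangentProj m Y) ≫ G.map f := by
    rw [← G.map_comp, tangentProj_naturality, G.map_comp]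
  have nj (j : Fin n) {Y Z : X} (f : Y ⟶ Z) : G.map (Weil.pow n ⊴ₗ f) ≫ G.map (Weil.proj j ⊵ₗ Z) =
      G.map (Weil.proj j ⊵ₗ Y) ≫ G.map (Weil.W ⊴ₗ f) := by
    rw [← G.map_comp, weilProj_naturality, G.map_comp]
  refine ⟨fun i => ?_, fun {Z} c f hf => ?_, fun {Z} f g hb hπ => ?_⟩
  · rw [← G.map_comp, ← G.map_comp, ← actionHomRight_comp, ← actionHomRight_comp, hw]
  · obtain ⟨u₀, hb₀, hπ₀⟩ := h0.exists_lift (c ≫ G.map (tangentProj n _))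
      (fun i => f i ≫ G.map (tangentProj n _)) fun i => by
        rw [Category.assoc, Category.assoc, ← np, ← np, ← Category.assoc, hf, Category.assoc]
    have ex (j : Fin n) := h1.exists_lift (c ≫ G.map (Weil.proj j ⊵ₗ _))
      (fun i => f i ≫ G.map (Weil.proj j ⊵ₗ _)) fun i => by
        rw [Category.assoc, Category.assoc, ← nj, ← nj, ← Category.assoc, hf, Category.assoc]
    choose u hb hπ using ex
    -- The `n` lifts to `T P` must lie over the common lift to `P` before they can be assembled into
    -- a morphism to `T_n P`.
    have hu (j : Fin n) : u j ≫ G.map (tangentProj 1 (H.obj P)) = u₀ := by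
      refine h0.hom_ext ?_ fun i => ?_
      · rw [Category.assoc, ← np, ← Category.assoc, hb, hb₀, Category.assoc]
        exact congrArg (c ≫ ·) ((fnd _).w j)
      · rw [Category.assoc, ← np, ← Category.assoc, hπ, hπ₀, Category.assoc]
        exact congrArg (f i ≫ ·) ((fnd _).w j)
    refine ⟨(fnd _).lift u₀ u hu, (fnd _).hom_ext ?_ fun j => ?_, fun i =>
      (fnd _).hom_ext ?_ fun j => ?_⟩
    · rw [Category.assoc, np, ← Category.assoc, (fnd _).lift_base, hb₀]
    · rw [Category.assoc, nj, ← Category.assoc, (fnd _).lift_π, hb]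
    · rw [Category.assoc, np, ← Category.assoc, (fnd _).lift_base, hπ₀]
    · rw [Category.assoc, nj, ← Category.assoc, (fnd _).lift_π, hπ]
  · refine (fnd _).hom_ext (h0.hom_ext ?_ fun i => ?_) fun j => h1.hom_ext ?_ fun i => ?_
    · rw [Category.assoc, Category.assoc, ← np, ← Category.assoc, hb, Category.assoc]
    · rw [Category.assoc, Category.assoc, ← np, ← Category.assoc, hπ, Category.assoc]
    · rw [Category.assoc, Category.assoc, ← nj, ← Category.assoc, hb, Category.assoc]
    · rw [Category.assoc, Category.assoc, ← nj, ← Category.assoc, hπ, Category.assoc]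

variable (X) in
/-- `T_ℕ` is isomorphic to the identity. -/
noncomputable def weilFunctorUnitIso : 𝟭 X ≅ weilFunctor X .unit :=
  (actionUnitNatIso Weil X).symm

variable (X) in
/-- `T_{A ⊗ A'}` is isomorphic to the composite of `T_{A'}` and `T_A`. -/
noncomputable def weilFunctorTensorIso (A A' : Weil) :
    weilFunctor X A' ⋙ weilFunctor X A ≅ weilFunctor X (.tensor A A') :=
  NatIso.ofComponents (fun Z => (αₗ A A' Z).symm) fun f => by
    have := tensor_actionHomRight A A' f
    change A ⊴ₗ A' ⊴ₗ f ≫ (αₗ A A' _).inv = (αₗ A A' _).inv ≫ (A ⊗ A') ⊴ₗ f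
    rw [this, Iso.inv_hom_id_assoc]

/-- The inner functor `H` and the exponent `k` are left free for the induction: for `A ⊗ A'`, the
hypothesis for `A'` provides the assumption under which the one for `A` is applied to `H ⋙
weilFunctor X A'`. -/
lemma PreservesPowerAlong.comp_weil [IsTangentActegory X] (A : Weil) : ∀ {H : X ⥤ X},
    (∀ k, PreservesPowerAlong q r b π (H ⋙ tangentIter X k)) → ∀ k : ℕ,
    PreservesPowerAlong q r b π (H ⋙ weilFunctor X A ⋙ tangentIter X k) := by
  induction A with
  | unit =>
    exact fun {H} h k => (h k).of_iso
      (Functor.isoWhiskerLeft H (Functor.isoWhiskerRight (weilFunctorUnitIso X) (tangentIter X k)))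
  | pow n => exact fun h k => .comp_pow h n k
  | tensor A A' ih ih' =>
    exact fun {H} h k => (ih (H := H ⋙ weilFunctor X A') (ih' h) k).of_iso (Functor.isoWhiskerLeft H
      (Functor.isoWhiskerRight (weilFunctorTensorIso X A A') (tangentIter X k)))

lemma PreservesPowerAlong.weil [IsTangentActegory X]
    (h : ∀ k, PreservesPowerAlong q r b π (tangentIter X k)) (A : Weil) :
    PreservesPowerAlong q r b π (weilFunctor X A) :=
  PreservesPowerAlong.comp_weil A (H := 𝟭 X) h 0

lemma isPullbackPower_weil [IsTangentActegory X] {E M P : X} {q : E ⟶ M} {n : ℕ} {b : P ⟶ M}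
    {π : Fin n → (P ⟶ E)}
    (h : ∀ k, IsPullbackPower ((tangentIter X k).map q) ((tangentIter X k).map b)
      fun i => (tangentIter X k).map (π i)) (A : Weil) :
    IsPullbackPower (A ⊴ₗ q) (A ⊴ₗ b) fun i => A ⊴ₗ π i :=
  isPullbackPower_map_iff.2 (.weil (fun k => isPullbackPower_map_iff.1 (h k)) A)

lemma isPullback_weil [IsTangentActegory X] {Y S Z P : X} {fst : P ⟶ Y} {snd : P ⟶ Z} {f : Y ⟶ S}
    {g : Z ⟶ S}
    (h : ∀ k, IsPullback ((tangentIter X k).map fst) ((tangentIter X k).map snd)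
      ((tangentIter X k).map f) ((tangentIter X k).map g)) (A : Weil) :
    IsPullback (A ⊴ₗ fst) (A ⊴ₗ snd) (A ⊴ₗ f) (A ⊴ₗ g) :=
  isPullback_iff_isPowerAlong.2
    (PreservesPowerAlong.weil (fun k => isPullback_iff_isPowerAlong.1 (h k)) A)

end Stability

/-! ### The commutative monoids of morphisms into an additive bundle -/

namespace BundleData

variable {X : Type u} [Category.{v} X] {B B' B'' : BundleData X}

lemma pair_congr {Z : X} {f f' g g' : Z ⟶ B.E} (hf : f = f') (hg : g = g')
    (h : f ≫ B.q = g ≫ B.q) :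
    B.pair f g h = B.pair f' g' (by rw [← hf, ← hg, h]) := by
  subst hf hg; rfl

lemma pair_eq {Z : X} {f g : Z ⟶ B.E} {h : f ≫ B.q = g ≫ B.q} {k : Z ⟶ B.pow 2}
    (h₀ : k ≫ B.π 2 0 = f) (h₁ : k ≫ B.π 2 1 = g) : B.pair f g h = k := by
  subst h₀ h₁
  refine B.hom_ext ?_ (Fin.forall_fin_two.2 ⟨B.pair_fst _ _ _, B.pair_snd _ _ _⟩)
  rw [B.pair_base, Category.assoc, B.π_q]

lemma IsAdditiveMorphism.pair_σ {φ : B.E ⟶ B'.E} {r : B.M ⟶ B'.M}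
    (m : IsAdditiveMorphism B B' φ r) {Z : X} (f g : Z ⟶ B.E) (h : f ≫ B.q = g ≫ B.q)
    (h' : (f ≫ φ) ≫ B'.q = (g ≫ φ) ≫ B'.q) :
    B'.pair (f ≫ φ) (g ≫ φ) h' ≫ B'.σ = (B.pair f g h ≫ B.σ) ≫ φ := by
  rw [Category.assoc, ← m.comm_σ, ← Category.assoc, B'.comp_pair]
  congr 1
  exact pair_congr (by rw [← Category.assoc, B.pair_fst]) (by rw [← Category.assoc, B.pair_snd]) _

lemma IsAdditiveMorphism.comp {φ : B.E ⟶ B'.E} {r : B.M ⟶ B'.M} {ψ : B'.E ⟶ B''.E}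
    {s : B'.M ⟶ B''.M} (m : IsAdditiveMorphism B B' φ r) (m' : IsAdditiveMorphism B' B'' ψ s) :
    IsAdditiveMorphism B B'' (φ ≫ ψ) (r ≫ s) where
  comm_q := by rw [Category.assoc, m'.comm_q, ← Category.assoc, m.comm_q, Category.assoc]
  comm_σ := by
    have h : (B.π 2 0 ≫ φ) ≫ B'.q = (B.π 2 1 ≫ φ) ≫ B'.q := by
      rw [Category.assoc, Category.assoc, m.comm_q, ← Category.assoc, ← Category.assoc, B.π_q,
        B.π_q]
    have h' : ((B.π 2 0 ≫ φ) ≫ ψ) ≫ B''.q = ((B.π 2 1 ≫ φ) ≫ ψ) ≫ B''.q := by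
      rw [Category.assoc, m'.comm_q, ← Category.assoc, h, Category.assoc, ← m'.comm_q,
        ← Category.assoc]
    refine (congrArg (· ≫ B''.σ) (pair_congr (Category.assoc _ _ _).symm
      (Category.assoc _ _ _).symm _)).trans ((m'.pair_σ _ _ h h').trans ?_)
    rw [m.comm_σ, Category.assoc]
  comm_ζ := by rw [Category.assoc, m'.comm_ζ, ← Category.assoc, m.comm_ζ, Category.assoc]

/-- The morphisms `Z ⟶ E` over `M`, where `Z` lies over `M` through `b`. -/
@[ext]
structure Over (hB : B.IsAdditive) {Z : X} (b : Z ⟶ B.M) : Type v where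
  hom : Z ⟶ B.E
  hom_q : hom ≫ B.q = b

variable (hB : B.IsAdditive) (hB' : B'.IsAdditive)

namespace Over

variable {Y Z : X} (b : Z ⟶ B.M)

instance : Add (Over hB b) where
  add f g := ⟨B.pair f.1 g.1 (f.2.trans g.2.symm) ≫ B.σ, by
    rw [Category.assoc, hB.σ_q, B.pair_base, f.2]⟩

instance : Zero (Over hB b) where
  zero := ⟨b ≫ B.ζ, by rw [Category.assoc, hB.ζ_q, Category.comp_id]⟩

variable {hB b}

lemma hom_add (f g : Over hB b) : (f + g).1 = B.pair f.1 g.1 (f.2.trans g.2.symm) ≫ B.σ := rfl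

lemma hom_zero : (0 : Over hB b).1 = b ≫ B.ζ := rfl

lemma add_comm_aux (f g : Over hB b) : f + g = g + f := by
  have := congrArg (B.pair g.1 f.1 (g.2.trans f.2.symm) ≫ ·) hB.comm
  simp only [← Category.assoc, B.comp_pair, B.pair_fst, B.pair_snd] at this
  exact Over.ext this

lemma zero_add_aux (f : Over hB b) : 0 + f = f := by
  have := congrArg (f.1 ≫ ·) hB.unit
  simp only [← Category.assoc, B.comp_pair, Category.comp_id] at this
  refine Over.ext (Eq.trans ?_ this)
  rw [hom_add, pair_congr (hom_zero.trans (congrArg (· ≫ B.ζ) f.2.symm)) rfl]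

lemma add_assoc_aux (f g k : Over hB b) : f + g + k = f + (g + k) := by
  have := congrArg (B.lift (n := 3) b ![f.1, g.1, k.1] (by
    intro i; fin_cases i
    · exact f.2
    · exact g.2
    · exact k.2) ≫ ·) hB.assoc
  simp only [← Category.assoc, B.comp_pair, B.lift_π] at this
  exact Over.ext this

instance : AddCommMonoid (Over hB b) where
  add_assoc := add_assoc_aux
  add_comm := add_comm_aux
  zero_add := zero_add_aux
  add_zero f := (add_comm_aux f 0).trans (zero_add_aux f)
  nsmul := nsmulRec

variable (hB) in
/-- Precomposition is additive. -/
def precomp (k : Y ⟶ Z) {b : Z ⟶ B.M} {c : Y ⟶ B.M} (h : k ≫ b = c) :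
    Over hB b →+ Over hB c where
  toFun f := ⟨k ≫ f.1, by rw [Category.assoc, f.2, h]⟩
  map_zero' := by
    subst h
    exact Over.ext (Category.assoc _ _ _).symm
  map_add' f g := Over.ext (by
    change _ ≫ _ ≫ _ = _ ≫ _
    rw [← Category.assoc, B.comp_pair])

@[simp]
lemma precomp_hom (k : Y ⟶ Z) {b : Z ⟶ B.M} {c : Y ⟶ B.M} (h : k ≫ b = c) (f : Over hB b) :
    (precomp hB k h f).1 = k ≫ f.1 := rfl

/-- Postcomposition with an additive bundle morphism is additive. -/
def postcomp {φ : B.E ⟶ B'.E} {r : B.M ⟶ B'.M} (m : IsAdditiveMorphism B B' φ r)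
    {b : Z ⟶ B.M} {c : Z ⟶ B'.M} (h : b ≫ r = c) : Over hB b →+ Over hB' c where
  toFun f := ⟨f.1 ≫ φ, by rw [Category.assoc, m.comm_q, ← Category.assoc, f.2, h]⟩
  map_zero' := Over.ext (by
    change (_ ≫ _) ≫ _ = _ ≫ _
    rw [Category.assoc, ← m.comm_ζ, ← Category.assoc, h])
  map_add' f g := Over.ext (m.pair_σ _ _ _ _).symm

@[simp]
lemma postcomp_hom {φ : B.E ⟶ B'.E} {r : B.M ⟶ B'.M} (m : IsAdditiveMorphism B B' φ r)
    {b : Z ⟶ B.M} {c : Z ⟶ B'.M} (h : b ≫ r = c) (f : Over hB b) :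
    (postcomp (hB' := hB') m h f).1 = f.1 ≫ φ := rfl

end Over

end BundleData

open BundleData

lemma actionAssoc_inv_naturality {X : Type u} [Category.{v} X] [MonoidalLeftAction Weil X]
    (A A' : Weil) {Y Z : X} (f : Y ⟶ Z) :
    (αₗ A A' Y).inv ≫ (A ⊗ A') ⊴ₗ f = A ⊴ₗ A' ⊴ₗ f ≫ (αₗ A A' Z).inv := by
  rw [tensor_actionHomRight, Iso.inv_hom_id_assoc]

/-! ### The image of a differential bundle under the action of a Weil algebra -/

namespace DifferentialBundle

variable {X : Type u} [Category.{v} X] [MonoidalLeftAction Weil X] [IsTangentActegory X]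
  (B : DifferentialBundle X)

/-- The bundle `(T_A E, T_A M, T_A q, T_A ζ, T_A σ)`. -/
abbrev weil (A : Weil) : BundleData X where
  E := A ⊙ₗ B.E
  M := A ⊙ₗ B.M
  q := A ⊴ₗ B.q
  powers := ⟨fun n => A ⊙ₗ B.pow n, fun n => A ⊴ₗ B.base n, fun n i => A ⊴ₗ B.π n i,
    fun n => isPullbackPower_weil (fun k => B.preserved k n) A⟩
  ζ := A ⊴ₗ B.ζ
  σ := A ⊴ₗ B.σ

lemma weil_pair (A : Weil) {Z : X} (f g : Z ⟶ B.E) (h : f ≫ B.q = g ≫ B.q) :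
    A ⊴ₗ B.pair f g h = (B.weil A).pair (A ⊴ₗ f) (A ⊴ₗ g)
      (by rw [← actionHomRight_comp, h, actionHomRight_comp]) := by
  refine (pair_eq (B := B.weil A) ?_ ?_).symm
  · rw [← actionHomRight_comp, BundleData.pair_fst]
  · rw [← actionHomRight_comp, BundleData.pair_snd]

/-- The axioms are equations between composites of pairs with `σ`, `ζ` and `q`, and `T_A` preserves
pairs. -/
lemma weil_additive (A : Weil) : (B.weil A).IsAdditive where
  σ_q := by rw [← actionHomRight_comp, B.additive.σ_q]
  ζ_q := by rw [← actionHomRight_comp, B.additive.ζ_q, actionHomRight_id]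
  assoc := by
    have := congrArg (A ⊴ₗ ·) B.additive.assoc
    simp only [actionHomRight_comp, weil_pair] at this
    exact this
  comm := by
    have := congrArg (A ⊴ₗ ·) B.additive.comm
    simp only [actionHomRight_comp, weil_pair] at this
    exact this
  unit := by
    have := congrArg (A ⊴ₗ ·) B.additive.unit
    simp only [actionHomRight_comp, weil_pair, actionHomRight_id] at this
    exact this

/-- The morphisms `Z ⟶ T_A E` over `T_A M`, where `Z` lies over `T_A M` through `c`. -/
abbrev WeilOver (A : Weil) {Z : X} (c : Z ⟶ A ⊙ₗ B.M) : Type v := Over (B.weil_additive A) c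

/-- All three conditions are naturality of the transformation induced by `f`, taken at `q`, `ζ`, `σ`
and the projections of `E₂`. -/
lemma isAdditiveMorphism_action {A A' : Weil} (f : A ⟶ A') :
    IsAdditiveMorphism (B.weil A) (B.weil A') (f ⊵ₗ B.E) (f ⊵ₗ B.M) where
  comm_q := (action_exchange _ _).symm
  comm_σ := by
    refine (congrArg (· ≫ A' ⊴ₗ B.σ) (pair_eq (B := B.weil A') (k := f ⊵ₗ B.pow 2) ?_ ?_)).trans
      (action_exchange _ _).symm
    · exact (action_exchange _ _).symm
    · exact (action_exchange _ _).symm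
  comm_ζ := (action_exchange _ _).symm

lemma isAdditiveMorphism_weilZero (A : Weil) :
    IsAdditiveMorphism B.toBundleData (B.weil A) (weilZero A B.E) (weilZero A B.M) where
  comm_q := (weilZero_naturality _ _).symm
  comm_σ := by
    refine (congrArg (· ≫ A ⊴ₗ B.σ) (pair_eq (B := B.weil A) (k := weilZero A (B.pow 2)) ?_ ?_)).trans
      (weilZero_naturality _ _).symm
    · exact (weilZero_naturality _ _).symm
    · exact (weilZero_naturality _ _).symm
  comm_ζ := (weilZero_naturality _ _).symm

lemma isAdditiveMorphism_lam :
    IsAdditiveMorphism B.toBundleData (B.weil Weil.W) B.lam (weilZero Weil.W B.M) :=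
  B.lam_zero

/-- The associativity isomorphism `T_A T_{A'} E ⟶ T_{A ⊗ A'} E` turns the image under `T_A` of a
pair into a pair. -/
lemma tensor_pair (A : Weil) {A' : Weil} {Z : X} (f g : Z ⟶ A' ⊙ₗ B.E)
    (h : f ≫ A' ⊴ₗ B.q = g ≫ A' ⊴ₗ B.q) :
    A ⊴ₗ ((B.weil A').pair f g h ≫ A' ⊴ₗ B.σ) ≫ (αₗ A A' B.E).inv =
      (B.weil (A ⊗ A')).pair (A ⊴ₗ f ≫ (αₗ A A' B.E).inv) (A ⊴ₗ g ≫ (αₗ A A' B.E).inv)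
        (by
          change (_ ≫ _) ≫ (A ⊗ A') ⊴ₗ _ = (_ ≫ _) ≫ (A ⊗ A') ⊴ₗ _
          rw [Category.assoc, Category.assoc, actionAssoc_inv_naturality,
            ← actionHomRight_comp_assoc, h, actionHomRight_comp_assoc]) ≫ (A ⊗ A') ⊴ₗ B.σ := by
  rw [actionHomRight_comp, Category.assoc, ← actionAssoc_inv_naturality, ← Category.assoc]
  refine (congrArg (· ≫ (A ⊗ A') ⊴ₗ B.σ) (pair_eq ?_ ?_)).symm
  · change (_ ≫ _) ≫ (A ⊗ A') ⊴ₗ _ = _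
    rw [Category.assoc, actionAssoc_inv_naturality, ← actionHomRight_comp_assoc,
      (B.weil A').pair_fst]
  · change (_ ≫ _) ≫ (A ⊗ A') ⊴ₗ _ = _
    rw [Category.assoc, actionAssoc_inv_naturality, ← actionHomRight_comp_assoc,
      (B.weil A').pair_snd]

/-- If `φ` is additive over `r`, then its image under `T_A` is additive. -/
lemma isAdditiveMorphism_tensor (A : Weil) {A' : Weil} {φ : B.E ⟶ A' ⊙ₗ B.E}
    {r : B.M ⟶ A' ⊙ₗ B.M} (m : IsAdditiveMorphism B.toBundleData (B.weil A') φ r) :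
    IsAdditiveMorphism (B.weil A) (B.weil (A ⊗ A')) (A ⊴ₗ φ ≫ (αₗ A A' B.E).inv)
      (A ⊴ₗ r ≫ (αₗ A A' B.M).inv) where
  comm_q := by
    change (_ ≫ _) ≫ (A ⊗ A') ⊴ₗ _ = A ⊴ₗ _ ≫ _
    rw [Category.assoc, actionAssoc_inv_naturality, ← actionHomRight_comp_assoc, m.comm_q,
      actionHomRight_comp_assoc]
  comm_σ := by
    refine Eq.trans ?_ (congrArg (· ≫ _) (congrArg (A ⊴ₗ ·) m.comm_σ)) |>.trans
      (actionHomRight_comp_assoc _ _ _ _)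
    refine Eq.trans ?_ (B.tensor_pair A _ _ _).symm
    congr 1
    exact pair_congr (actionHomRight_comp_assoc _ _ _ _).symm
      (actionHomRight_comp_assoc _ _ _ _).symm _
  comm_ζ := by
    change (_ ≫ _) ≫ (A ⊗ A') ⊴ₗ _ = A ⊴ₗ _ ≫ _
    rw [Category.assoc, actionAssoc_inv_naturality, ← actionHomRight_comp_assoc, m.comm_ζ,
      actionHomRight_comp_assoc]

/-- The morphisms over `M` form the same monoid as the morphisms into the additive bundle. -/
def homOverEquiv {Z : X} (b : Z ⟶ B.M) : HomOver B b ≃+ Over B.additive b where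
  toFun f := ⟨f.1, f.2⟩
  invFun f := ⟨f.1, f.2⟩
  map_add' _ _ := rfl

/-- The action of `T_A` on morphisms over `M`. -/
def weilMap (A : Weil) {Z : X} (b : Z ⟶ B.M) : HomOver B b →+ B.WeilOver A (A ⊴ₗ b) where
  toFun f := ⟨A ⊴ₗ f.1, by rw [← actionHomRight_comp, f.2]⟩
  map_zero' := Over.ext (actionHomRight_comp _ _ _)
  map_add' f g := Over.ext (by
    change A ⊴ₗ (_ ≫ _) = _ ≫ _
    rw [actionHomRight_comp, B.weil_pair])

/-- The action of `T_A` on morphisms over `T_{A'} M`. -/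
def tensorMap (A : Weil) {A' : Weil} {Z : X} {c : Z ⟶ A' ⊙ₗ B.M} :
    B.WeilOver A' c →+ B.WeilOver (A ⊗ A') (A ⊴ₗ c ≫ (αₗ A A' B.M).inv) where
  toFun f := ⟨A ⊴ₗ f.hom ≫ (αₗ A A' B.E).inv, by
    change (_ ≫ _) ≫ (A ⊗ A') ⊴ₗ _ = _
    rw [Category.assoc, actionAssoc_inv_naturality, ← actionHomRight_comp_assoc, f.hom_q]⟩
  map_zero' := Over.ext (by
    change A ⊴ₗ (_ ≫ _) ≫ _ = (_ ≫ _) ≫ (A ⊗ A') ⊴ₗ _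
    rw [Category.assoc, actionAssoc_inv_naturality, actionHomRight_comp_assoc])
  map_add' f g := Over.ext (B.tensor_pair A _ _ _)

end DifferentialBundle

/-! ### Monomials of Weil algebras -/

namespace Weil

/-- The monomial `1`. -/
def Mon.one : (A : Weil) → A.Mon
  | unit => ()
  | pow _ => none
  | tensor A B => (Mon.one A, Mon.one B)

/-- The monomial `xᵢ`. -/
def Mon.var {n : ℕ} (i : Fin n) : (pow n).Mon := some i

lemma basis_pow {n : ℕ} (o : Option (Fin n)) :
    (pow n).basis o = (powCoord n).symm (Pi.single o 1) :=
  congrFun (Module.Basis.coe_ofEquivFun (powCoord n)) o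

lemma basis_none (n : ℕ) : (pow n).basis none = 1 := by
  refine (basis_pow none).trans ((LinearEquiv.symm_apply_eq (powCoord n)).2 (funext fun o => ?_))
  change _ = Option.elim o (TrivSqZeroExt.fst (1 : TrivSqZeroExt ℕ (Fin n → ℕ)))
    (TrivSqZeroExt.snd (1 : TrivSqZeroExt ℕ (Fin n → ℕ)))
  cases o <;> simp

lemma basis_var {n : ℕ} (i : Fin n) : (pow n).basis (Mon.var i) = var i := by
  refine (basis_pow (some i)).trans
    ((LinearEquiv.symm_apply_eq (powCoord n)).2 (funext fun o => ?_))
  change _ = Option.elim o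
    (TrivSqZeroExt.fst (TrivSqZeroExt.inr (Pi.single i 1) : TrivSqZeroExt ℕ (Fin n → ℕ)))
    (TrivSqZeroExt.snd (TrivSqZeroExt.inr (Pi.single i 1) : TrivSqZeroExt ℕ (Fin n → ℕ)))
  cases o <;> simp [Pi.single_apply]

lemma basis_one : ∀ A : Weil, A.basis (Mon.one A) = 1
  | unit => Module.Basis.singleton_apply Unit ℕ ()
  | pow n => basis_none n
  | tensor A B => by
    refine (basis_pair (Mon.one A) (Mon.one B)).trans ?_
    rw [basis_one A, basis_one B]; rfl

/-- A monomial other than `1` squares to zero. -/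
lemma eq_one_or_basis_mul_self : ∀ {A : Weil} (m : A.Mon),
    m = Mon.one A ∨ A.basis m * A.basis m = 0
  | unit, _ => .inl rfl
  | pow _, none => .inl rfl
  | pow _, some i => .inr ((congrArg (fun a => a * a) (basis_var i)).trans (var_mul_var i i))
  | tensor A B, (a, b) => by
    have key : (A ⊗ B).basis (Mon.pair a b) * (A ⊗ B).basis (Mon.pair a b) =
        tmul (A.basis a * A.basis a) (B.basis b * B.basis b) := by
      rw [basis_pair, tmul_mul_tmul]
    rcases eq_one_or_basis_mul_self a with rfl | ha
    · rcases eq_one_or_basis_mul_self b with rfl | hb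
      · exact .inl rfl
      · exact .inr (key.trans (by rw [hb, tmul_zero]))
    · exact .inr (key.trans (by rw [ha, zero_tmul]))

/-! ### Positivity of the coefficients and elements of square zero -/

lemma eq_zero_of_add_eq_zero {A : Weil} {x y : A.alg} (h : x + y = 0) : x = 0 ∧ y = 0 := by
  have key : ∀ m, A.basis.repr x m = 0 ∧ A.basis.repr y m = 0 := fun m => by
    have := congrArg (fun z => A.basis.repr z m) h
    simp only [map_add, map_zero, Finsupp.add_apply, Finsupp.zero_apply] at this
    omega
  exact ⟨A.basis.repr.map_eq_zero_iff.1 (Finsupp.ext fun m => (key m).1),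
    A.basis.repr.map_eq_zero_iff.1 (Finsupp.ext fun m => (key m).2)⟩

/-- There is no cancellation over `ℕ`: the expanded square is a sum, and a vanishing sum has
vanishing terms. The mixed product being zero is what allows `x` and `y` to be the images of the two
generators of `W²`. -/
lemma mul_eq_zero_of_add_mul_self {A : Weil} {x y : A.alg} (h : (x + y) * (x + y) = 0) :
    x * x = 0 ∧ x * y = 0 ∧ y * y = 0 := by
  have e : (x + y) * (x + y) = x * x + (x * y + (x * y + y * y)) := by ring
  rw [e] at h
  obtain ⟨h1, h⟩ := eq_zero_of_add_eq_zero h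
  obtain ⟨h2, h⟩ := eq_zero_of_add_eq_zero h
  exact ⟨h1, h2, (eq_zero_of_add_eq_zero h).2⟩

/-- The morphism `W ⟶ A`, `x ↦ a`, for an element `a` with `a² = 0`. -/
def elt {A : Weil} (a : A.alg) (ha : a * a = 0) : W ⟶ A := desc (fun _ => a) fun _ _ => ha

lemma map_mul_self {A B : Weil} (f : A ⟶ B) {a : A.alg} (ha : a * a = 0) :
    f.hom a * f.hom a = 0 := by rw [← map_mul, ha, map_zero]

lemma elt_var {A : Weil} {a : A.alg} (ha : a * a = 0) (i : Fin 1) : (elt a ha).hom (var i) = a :=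
  desc_var _ _ i

lemma elt_comp {A B : Weil} (f : A ⟶ B) {a : A.alg} (ha : a * a = 0) :
    elt a ha ≫ f = elt (f.hom a) (map_mul_self f ha) :=
  hom_ext_var fun i => by
    rw [comp_hom, RingHom.comp_apply, elt_var, elt_var]

lemma elt_zero (A : Weil) : elt (0 : A.alg) (zero_mul _) = aug 1 ≫ const A :=
  hom_ext_var fun i => by
    rw [comp_hom, RingHom.comp_apply, elt_var, aug, desc_var, map_zero]

lemma tmul_mul_self_left {A B : Weil} {a : A.alg} (ha : a * a = 0) (b : B.alg) :
    tmul a b * tmul a b = 0 := by rw [tmul_mul_tmul, ha, zero_tmul]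

/-- The inclusion `A ⟶ A ⊗ B`. -/
def inl (A B : Weil) : A ⟶ A ⊗ B := (ρ_ A).inv ≫ A ◁ const B

/-- The inclusion `B ⟶ A ⊗ B`. -/
def inr (A B : Weil) : B ⟶ A ⊗ B := (λ_ B).inv ≫ const A ▷ B

lemma inl_hom {A B : Weil} (a : A.alg) : (inl A B).hom a = tmul a 1 := by
  change tmul a (Nat.castRingHom B.alg 1) = _
  rw [map_one]

lemma inr_hom {A B : Weil} (b : B.alg) : (inr A B).hom b = tmul 1 b := by
  change tmul (Nat.castRingHom A.alg 1) b = _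
  rw [map_one]

/-- The lift along a product of two square-zero elements factors through `ℓ`; this is where
coassociativity of `λ` will enter. -/
lemma ell_tensorHom {A B : Weil} {a : A.alg} {b : B.alg} (ha : a * a = 0) (hb : b * b = 0) :
    ell ≫ (elt a ha ⊗ₘ elt b hb) = elt (tmul a b) (tmul_mul_self_left ha b) :=
  hom_ext_var fun i => by
    rw [comp_hom, RingHom.comp_apply, ell, desc_var, elt_var]
    refine (tensorMap_tmul (elt a ha).hom (elt b hb).hom (var 0) (var 0)).trans ?_
    rw [elt_var, elt_var]; rfl

end Weil

/-! ### Zeros and the associativity isomorphism of the action -/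

section

variable {X : Type u} [Category.{v} X] [MonoidalLeftAction Weil X]

/-- Up to associativity, zeros are induced by the inclusions of the tensor factors. This one, at
`T_{A'} Z`, gives the right inclusion, and `action_weilZero_inv` gives the left one. -/
lemma weilZero_action_inv (A A' : Weil) (Z : X) :
    weilZero A (A' ⊙ₗ Z) ≫ (αₗ A A' Z).inv = Weil.inr A A' ⊵ₗ Z := by
  rw [Weil.inr, comp_actionHomLeft, whiskerRight_actionHomLeft, weilZero]
  have : (λ_ A').inv ⊵ₗ Z ≫ (αₗ (𝟙_ Weil) A' Z).hom = (λₗ (A' ⊙ₗ Z)).inv := by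
    rw [← cancel_mono (λₗ (A' ⊙ₗ Z)).hom, Category.assoc, ← leftUnitor_actionHom,
      ← comp_actionHomLeft, Iso.inv_hom_id, Iso.inv_hom_id, id_actionHomLeft]
  rw [← this]; simp only [Category.assoc]

lemma action_weilZero_inv (A A' : Weil) (Z : X) :
    A ⊴ₗ weilZero A' Z ≫ (αₗ A A' Z).inv = Weil.inl A A' ⊵ₗ Z := by
  rw [Weil.inl, comp_actionHomLeft, whiskerLeft_actionHomLeft, weilZero, actionHomRight_comp]
  have : (ρ_ A).inv ⊵ₗ Z ≫ (αₗ A (𝟙_ Weil) Z).hom = A ⊴ₗ (λₗ Z).inv := by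
    rw [← cancel_mono (A ⊴ₗ (λₗ Z).hom), Category.assoc, ← rightUnitor_actionHom,
      ← comp_actionHomLeft, Iso.inv_hom_id, ← actionHomRight_comp, Iso.inv_hom_id,
      id_actionHomLeft, actionHomRight_id]
  rw [← this]; simp only [Category.assoc]

lemma weilZero_tensor (A A' : Weil) (Z : X) :
    weilZero A Z ≫ A ⊴ₗ weilZero A' Z ≫ (αₗ A A' Z).inv = weilZero (A ⊗ A') Z := by
  rw [action_weilZero_inv, weilZero_map]

lemma isPower_tangent [IsTangentActegory X] (n : ℕ) (Z : X) :
    IsPullbackPower (tangentProj 1 Z) (tangentProj n Z) fun j : Fin n => Weil.proj j ⊵ₗ Z :=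
  IsTangentActegory.foundational 0 n Z

end

/-! ### Lifts along monomials -/

namespace DifferentialBundle

open BundleData

variable {X : Type u} [Category.{v} X] [MonoidalLeftAction Weil X] [IsTangentActegory X]
  (B : DifferentialBundle X)

/-- Postcomposition with the transformation `T_A ⟶ T_{A'}` induced by `f`. -/
def mapWeil {A A' : Weil} (f : A ⟶ A') {Z : X} {c : Z ⟶ A ⊙ₗ B.M} {c' : Z ⟶ A' ⊙ₗ B.M}
    (h : c ≫ f ⊵ₗ B.M = c') : B.WeilOver A c →+ B.WeilOver A' c' :=
  Over.postcomp _ (B.isAdditiveMorphism_action f) h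

lemma q_weilZero_map {A A' : Weil} (f : A ⟶ A') :
    (B.q ≫ weilZero A B.M) ≫ f ⊵ₗ B.M = B.q ≫ weilZero A' B.M := by
  rw [Category.assoc, weilZero_map]

/-- The composite of `λ` with the transformation `T ⟶ T_A` induced by `x ↦ a`, where `a² = 0`. -/
def nilLift {A : Weil} (a : A.alg) (ha : a * a = 0) : B.E ⟶ A ⊙ₗ B.E :=
  B.lam ≫ Weil.elt a ha ⊵ₗ B.E

lemma isAdditiveMorphism_nilLift {A : Weil} (a : A.alg) (ha : a * a = 0) :
    IsAdditiveMorphism B.toBundleData (B.weil A) (B.nilLift a ha) (weilZero A B.M) := by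
  have := B.isAdditiveMorphism_lam.comp (B.isAdditiveMorphism_action (Weil.elt a ha))
  rwa [weilZero_map] at this

/-- `nilLift` as a morphism over the zero of `T_A M`. -/
def nil {A : Weil} (a : A.alg) (ha : a * a = 0) : B.WeilOver A (B.q ≫ weilZero A B.M) :=
  ⟨B.nilLift a ha, (B.isAdditiveMorphism_nilLift a ha).comm_q⟩

lemma nil_congr {A : Weil} {a a' : A.alg} (h : a = a') (ha : a * a = 0) :
    B.nil a ha = B.nil a' (h ▸ ha) := by
  subst h; rfl

lemma nil_map {A A' : Weil} (f : A ⟶ A') {a : A.alg} (ha : a * a = 0) :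
    B.mapWeil f (B.q_weilZero_map f) (B.nil a ha) = B.nil (f.hom a) (Weil.map_mul_self f ha) :=
  Over.ext (by
    change (B.lam ≫ _) ≫ f ⊵ₗ B.E = B.lam ≫ _
    rw [Category.assoc, ← comp_actionHomLeft, Weil.elt_comp])

/-- The map `x ↦ 0` factors through `p`, and `p ∘ λ = ζ ∘ q`, since `(λ, ζ)` is a bundle morphism.
-/
lemma nil_zero (A : Weil) : B.nil (0 : A.alg) (zero_mul _) = 0 :=
  Over.ext (by
    have hl : B.lam ≫ tangentProj 1 B.E = B.q ≫ B.ζ := B.lam_ζ.comm_q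
    change B.lam ≫ _ = (B.q ≫ _) ≫ A ⊴ₗ B.ζ
    rw [Category.assoc, ← weilZero_naturality, ← Category.assoc, ← hl, Weil.elt_zero,
      comp_actionHomLeft, tangentProj, weilZero]
    simp only [Category.assoc, Iso.hom_inv_id_assoc])

/-- This is the universal case of additivity. A morphism into `T_2 E` is determined by its base and
two components in `T E`, and each of the corresponding algebra maps kills at least one generator,
where the claim reduces to `0 + f = f` or `f + 0 = f`. -/
lemma nil_add_pow_two (h : (Weil.var 0 + Weil.var 1 : (Weil.pow 2).alg) *
      (Weil.var 0 + Weil.var 1) = 0) :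
    B.nil _ h = B.nil _ (Weil.var_mul_var 0 0) + B.nil _ (Weil.var_mul_var 1 1) := by
  have key {A' : Weil} (f : Weil.pow 2 ⟶ A') (hf : f.hom (Weil.var 0) = 0 ∨ f.hom (Weil.var 1) = 0) :
      B.mapWeil f (B.q_weilZero_map f) (B.nil _ h) = B.mapWeil f (B.q_weilZero_map f)
        (B.nil _ (Weil.var_mul_var 0 0) + B.nil _ (Weil.var_mul_var 1 1)) := by
    rw [map_add, nil_map, nil_map, nil_map]
    rcases hf with hf | hf
    · rw [B.nil_congr hf, nil_zero, zero_add]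
      exact B.nil_congr (by rw [map_add, hf, zero_add]) _
    · rw [B.nil_congr hf, nil_zero, add_zero]
      exact B.nil_congr (by rw [map_add, hf, add_zero]) _
  refine Over.ext ((isPower_tangent 2 B.E).hom_ext ?_ (Fin.forall_fin_two.2 ⟨?_, ?_⟩))
  · rw [tangentProj, ← Category.assoc, ← Category.assoc]
    exact congrArg (· ≫ (λₗ B.E).hom) (congrArg Over.hom (key (Weil.aug 2) (.inl (by
      rw [Weil.aug, Weil.desc_var]))))
  · exact congrArg Over.hom (key (Weil.proj 0) (.inr (by rw [Weil.proj, Weil.desc_var]; rfl)))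
  · exact congrArg Over.hom (key (Weil.proj 1) (.inl (by rw [Weil.proj, Weil.desc_var]; rfl)))

/-- The universal identity in `W²` is pushed forward along `x₁ ↦ a, x₂ ↦ a'`. Only the square of the
sum has to be assumed zero, by positivity. -/
lemma nil_add {A : Weil} {a a' : A.alg} (h : (a + a') * (a + a') = 0) :
    B.nil (a + a') h = B.nil a (Weil.mul_eq_zero_of_add_mul_self h).1 +
      B.nil a' (Weil.mul_eq_zero_of_add_mul_self h).2.2 := by
  obtain ⟨h1, h2, h3⟩ := Weil.mul_eq_zero_of_add_mul_self h
  let f : Weil.pow 2 ⟶ A := Weil.desc ![a, a'] fun i j => by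
    fin_cases i <;> fin_cases j
    · exact h1
    · exact h2
    · exact (mul_comm _ _).trans h2
    · exact h3
  have e0 : f.hom (Weil.var 0) = a := Weil.desc_var _ _ 0
  have e1 : f.hom (Weil.var 1) = a' := Weil.desc_var _ _ 1
  have := congrArg (B.mapWeil f (B.q_weilZero_map f)) (B.nil_add_pow_two (by
    simp only [mul_add, add_mul, Weil.var_mul_var, add_zero]))
  rw [map_add, nil_map, nil_map, nil_map, B.nil_congr e0, B.nil_congr e1] at this
  refine Eq.trans (B.nil_congr ?_ _) this
  rw [map_add, e0, e1]

/-- The lift `E ⟶ T_A E` along a monomial: `0` for the monomial `1`, and `λ` followed by `x ↦ m`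
for any other monomial `m`. -/
def monLift (A : Weil) (m : A.Mon) : B.WeilOver A (B.q ≫ weilZero A B.M) :=
  if h : m = Weil.Mon.one A then ⟨weilZero A B.E, (B.isAdditiveMorphism_weilZero A).comm_q⟩
  else B.nil (A.basis m) ((Weil.eq_one_or_basis_mul_self m).resolve_left h)

lemma monLift_one (A : Weil) : (B.monLift A (.one A)).hom = weilZero A B.E := by
  rw [monLift, dif_pos rfl]

lemma monLift_of_ne {A : Weil} {m : A.Mon} (h : m ≠ .one A) : B.monLift A m =
    B.nil (A.basis m) ((Weil.eq_one_or_basis_mul_self m).resolve_left h) := by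
  rw [monLift, dif_neg h]

lemma isAdditiveMorphism_monLift (A : Weil) (m : A.Mon) :
    IsAdditiveMorphism B.toBundleData (B.weil A) (B.monLift A m).hom (weilZero A B.M) := by
  by_cases h : m = Weil.Mon.one A
  · subst h
    rw [monLift_one]
    exact B.isAdditiveMorphism_weilZero A
  · rw [B.monLift_of_ne h]
    exact B.isAdditiveMorphism_nilLift _ _

/-- The `ℕ`-linear extension of `monLift`. -/
def evalLift (A : Weil) : A.alg →+ B.WeilOver A (B.q ≫ weilZero A B.M) where
  toFun a := ∑ m, A.basis.repr a m • B.monLift A m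
  map_zero' := by simp
  map_add' a a' := by simp [add_smul, Finset.sum_add_distrib]

lemma evalLift_apply (A : Weil) (a : A.alg) :
    B.evalLift A a = ∑ m, A.basis.repr a m • B.monLift A m := rfl

lemma evalLift_basis (A : Weil) (m : A.Mon) : B.evalLift A (A.basis m) = B.monLift A m := by
  rw [evalLift_apply, Finset.sum_eq_single m]
  · rw [Weil.repr_basis, if_pos rfl, one_smul]
  · intro m' _ h
    rw [Weil.repr_basis, if_neg h, zero_smul]
  · simp

lemma basis_mul_self_ne_zero (A : Weil) : A.basis (.one A) * A.basis (.one A) ≠ 0 := by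
  intro h
  rw [Weil.basis_one, mul_one, ← Weil.basis_one] at h
  exact A.basis.ne_zero _ h

/-- By additivity, the property passes from the monomials to all their `ℕ`-combinations. The
condition `a² = 0` is quantified inside the induction because positivity hands it down to the
summands. -/
lemma nil_eq_evalLift {A : Weil} (a : A.alg) : ∀ ha : a * a = 0, B.nil a ha = B.evalLift A a := by
  refine Submodule.span_induction (R := ℕ) (s := Set.range A.basis)
    (p := fun a _ => ∀ ha : a * a = 0, B.nil a ha = B.evalLift A a) ?_ ?_ ?_ ?_
    (A.basis.mem_span a)
  · rintro _ ⟨m, rfl⟩ ha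
    -- The case `m = 1` is excluded by `1² ≠ 0`. It has to be, because the lift along `1` is the
    -- zero of `T_A` rather than a lift through `λ`.
    have h : m ≠ .one A := by
      rintro rfl
      exact basis_mul_self_ne_zero A ha
    rw [evalLift_basis, B.monLift_of_ne h]
  · intro ha
    rw [map_zero, ← B.nil_zero A]
  · intro x y _ _ hx hy h
    rw [map_add, B.nil_add h, hx, hy]
  · intro n x _ hx
    induction n with
    | zero =>
      intro ha
      rw [B.nil_congr (zero_smul ℕ x), nil_zero, zero_smul, map_zero]
    | succ n ih =>
      intro ha
      have e : (n + 1) • x = n • x + x := succ_nsmul x n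
      refine (B.nil_congr e ha).trans ((B.nil_add _).trans ?_)
      rw [ih, hx, ← map_add, ← e]

/-- The image of a monomial need not be a monomial. For `m ≠ 1` it is a square-zero element, whose
lift is known to be the linear extension; for `m = 1` zeros go to zeros. -/
lemma monLift_map {A A' : Weil} (f : A ⟶ A') (m : A.Mon) :
    B.mapWeil f (B.q_weilZero_map f) (B.monLift A m) = B.evalLift A' (f.hom (A.basis m)) := by
  by_cases h : m = Weil.Mon.one A
  · subst h
    rw [Weil.basis_one, map_one, ← Weil.basis_one, evalLift_basis]
    refine Over.ext ?_
    change (B.monLift A _).hom ≫ f ⊵ₗ B.E = _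
    rw [monLift_one, monLift_one, weilZero_map]
  · rw [B.monLift_of_ne h, nil_map, nil_eq_evalLift]

/-- If one factor is `1`, the zero contributes only the inclusion of the other tensor factor. If
neither is, both sides are `λ` followed by `x ↦ a ⊗ a'`, by coassociativity of `λ`. -/
lemma monLift_pair {A A' : Weil} (a : A.Mon) (a' : A'.Mon) :
    (B.monLift A a).hom ≫ A ⊴ₗ (B.monLift A' a').hom ≫ (αₗ A A' B.E).inv =
      (B.monLift (A ⊗ A') (a.pair a')).hom := by
  by_cases h : a = .one A
  · subst h
    rw [monLift_one, ← Category.assoc, ← weilZero_naturality, Category.assoc, weilZero_action_inv]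
    by_cases h' : a' = .one A'
    · subst h'
      rw [monLift_one, weilZero_map]
      exact (B.monLift_one (A ⊗ A')).symm
    · have hp : Weil.Mon.pair (Weil.Mon.one A) a' ≠ .one (A ⊗ A') :=
        fun e => h' (congrArg Prod.snd e)
      rw [B.monLift_of_ne hp, B.monLift_of_ne h']
      change (B.lam ≫ _) ≫ _ = B.lam ≫ _
      rw [Category.assoc, ← comp_actionHomLeft, Weil.elt_comp]
      congr! 3
      rw [Weil.inr_hom, Weil.basis_pair, Weil.basis_one]
  · have hp : Weil.Mon.pair a a' ≠ .one (A ⊗ A') := fun e => h (congrArg Prod.fst e)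
    rw [B.monLift_of_ne hp, B.monLift_of_ne h]
    by_cases h' : a' = .one A'
    · subst h'
      rw [monLift_one, action_weilZero_inv]
      change (B.lam ≫ _) ≫ _ = B.lam ≫ _
      rw [Category.assoc, ← comp_actionHomLeft, Weil.elt_comp]
      congr! 3
      rw [Weil.inl_hom, Weil.basis_pair, Weil.basis_one]
    · rw [B.monLift_of_ne h']
      change (B.lam ≫ Weil.elt _ _ ⊵ₗ _) ≫ A ⊴ₗ (B.lam ≫ Weil.elt _ _ ⊵ₗ _) ≫ _ = B.lam ≫ _
      have ha := (Weil.eq_one_or_basis_mul_self a).resolve_left h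
      have ha' := (Weil.eq_one_or_basis_mul_self a').resolve_left h'
      -- Naturality of associativity splits the map induced by `x ⊗ x ↦ a ⊗ a'` on `T T E` into one
      -- map per factor.
      have nat := actionAssocIso_hom_naturality (Weil.elt _ ha) (Weil.elt _ ha') (𝟙 B.E)
      rw [actionHom_id, actionHom_id, actionHom_def, ← Iso.eq_comp_inv, Category.assoc,
        Category.assoc] at nat
      have e : Weil.ell ⊵ₗ B.E ≫ (Weil.elt _ ha ⊗ₘ Weil.elt _ ha') ⊵ₗ B.E =
          Weil.elt _ ((Weil.eq_one_or_basis_mul_self (A := A ⊗ A') (a.pair a')).resolve_left hp) ⊵ₗ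
            B.E := by
        rw [← comp_actionHomLeft, Weil.ell_tensorHom]
        congr! 2
        rw [Weil.basis_pair]
      rw [← e, nat]
      -- Coassociativity replaces `ℓ ∘ λ` by `T(λ) ∘ λ`; the exchange law then moves the map `x ↦ a`
      -- past `T(λ)`.
      have l := B.lam_lam
      rw [tangentLift] at l
      have l' := congrArg (· ≫ (Weil.elt _ ha ⊵ₗ _ ≫ A ⊴ₗ Weil.elt _ ha' ⊵ₗ _ ≫
        (αₗ A A' B.E).inv)) l
      simp only [Category.assoc] at l' ⊢
      rw [l', ← action_exchange_assoc, ← action_exchange_assoc, actionHomRight_comp,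
        Category.assoc]

end DifferentialBundle

/-! ### The lineator as a sum over monomials -/

lemma weilZero_unit {X : Type u} [Category.{v} X] [MonoidalLeftAction Weil X] (Z : X) :
    weilZero (𝟙_ Weil) Z = (λₗ Z).inv := by
  have : Weil.const (𝟙_ Weil) = 𝟙 _ := Weil.hom_ext_unit
  rw [weilZero, this, id_actionHomLeft, Category.comp_id]

namespace DifferentialBundle

open BundleData

variable {X : Type u} [Category.{v} X] [MonoidalLeftAction Weil X] [IsTangentActegory X]
  (B : DifferentialBundle X)

/-- Postcomposition with the lift along a monomial. -/
def monPost (A : Weil) (m : A.Mon) {Z : X} {b : Z ⟶ B.M} {c : Z ⟶ A ⊙ₗ B.M}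
    (h : b ≫ weilZero A B.M = c) : HomOver B b →+ B.WeilOver A c :=
  (Over.postcomp (B.weil_additive A) (B.isAdditiveMorphism_monLift A m) h).comp
    (B.homOverEquiv b).toAddMonoidHom

lemma monPost_hom (A : Weil) (m : A.Mon) {Z : X} {b : Z ⟶ B.M} {c : Z ⟶ A ⊙ₗ B.M}
    (h : b ≫ weilZero A B.M = c) (e : HomOver B b) :
    (B.monPost A m h e).hom = e.1 ≫ (B.monLift A m).hom := rfl

lemma precomp_monPost (A : Weil) (m : A.Mon) {Y Z : X} {b : Z ⟶ B.M} {c : Z ⟶ A ⊙ₗ B.M}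
    (h : b ≫ weilZero A B.M = c) (e : HomOver B b) (k : Y ⟶ Z) {b' : Y ⟶ B.M}
    {c' : Y ⟶ A ⊙ₗ B.M} (hb : k ≫ b = b') (hc : k ≫ c = c') (h' : b' ≫ weilZero A B.M = c') :
    Over.precomp (B.weil_additive A) k hc (B.monPost A m h e) =
      B.monPost A m h' (B.precomp k hb e) :=
  Over.ext (Category.assoc _ _ _).symm

/-- The composite of a morphism over `M` with the lift along an element of `A`. -/
def evalPost (A : Weil) (a : A.alg) {Z : X} {b : Z ⟶ B.M} {c : Z ⟶ A ⊙ₗ B.M}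
    (h : b ≫ weilZero A B.M = c) (e : HomOver B b) : B.WeilOver A c :=
  Over.precomp (B.weil_additive A) e.1 (by rw [← Category.assoc, e.2, h]) (B.evalLift A a)

lemma evalPost_basis (A : Weil) (m : A.Mon) {Z : X} {b : Z ⟶ B.M} {c : Z ⟶ A ⊙ₗ B.M}
    (h : b ≫ weilZero A B.M = c) (e : HomOver B b) :
    B.evalPost A (A.basis m) h e = B.monPost A m h e := by
  rw [evalPost, evalLift_basis]; rfl

lemma evalPost_zero (A : Weil) {Z : X} {b : Z ⟶ B.M} {c : Z ⟶ A ⊙ₗ B.M}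
    (h : b ≫ weilZero A B.M = c) (e : HomOver B b) : B.evalPost A 0 h e = 0 := by
  rw [evalPost, map_zero, map_zero]

lemma evalPost_apply (A : Weil) (a : A.alg) {Z : X} {b : Z ⟶ B.M} {c : Z ⟶ A ⊙ₗ B.M}
    (h : b ≫ weilZero A B.M = c) (e : HomOver B b) :
    B.evalPost A a h e = ∑ m, A.basis.repr a m • B.monPost A m h e := by
  rw [evalPost, evalLift_apply, map_sum]
  exact Finset.sum_congr rfl fun m _ => map_nsmul _ _ _

lemma mapWeil_monPost {A A' : Weil} (f : A ⟶ A') (m : A.Mon) {Z : X} {b : Z ⟶ B.M}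
    {c : Z ⟶ A ⊙ₗ B.M} {c' : Z ⟶ A' ⊙ₗ B.M} (h : b ≫ weilZero A B.M = c)
    (h' : b ≫ weilZero A' B.M = c') (hc : c ≫ f ⊵ₗ B.M = c') (e : HomOver B b) :
    B.mapWeil f hc (B.monPost A m h e) = B.evalPost A' (f.hom (A.basis m)) h' e := by
  rw [evalPost, ← B.monLift_map]
  exact Over.ext (Category.assoc _ _ _)

/-- For `m = x` the inducing map `W ⟶ W` is the identity, so the lift along `x` is `λ` itself, and
the two monomials account for the two terms of the definition. -/
lemma alphaW_eq : B.alphaW = (B.monPost Weil.W (.one Weil.W) rfl (B.proj 2 0) +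
    B.monPost Weil.W (.var 0) rfl (B.proj 2 1)).hom := by
  have h1 : (B.monLift Weil.W (.var 0)).hom = B.lam := by
    have hp : (Weil.Mon.var 0 : Weil.W.Mon) ≠ .one Weil.W := Option.some_ne_none _
    rw [B.monLift_of_ne hp]
    have : Weil.elt (Weil.W.basis (.var 0))
        ((Weil.eq_one_or_basis_mul_self (A := Weil.W) (.var 0)).resolve_left hp) = 𝟙 _ :=
      Weil.hom_ext_var fun i => by
        rw [Weil.elt_var, Subsingleton.elim i 0]; exact Weil.basis_var 0
    change B.lam ≫ _ = _
    rw [this, id_actionHomLeft, Category.comp_id]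
  refine congrArg (· ≫ Weil.W ⊴ₗ B.σ) (pair_congr (B := B.weil Weil.W) ?_ ?_ _)
  · exact congrArg (B.π 2 0 ≫ ·) (B.monLift_one Weil.W).symm
  · exact congrArg (B.π 2 1 ≫ ·) h1.symm

/-- Both sides are compared under the maps that exhibit `T_n E` as a pullback power: the
augmentation kills every term but that of `1`, and the `j`-th projection leaves only the terms of
`1` and `xⱼ`. -/
lemma alphaPow_eq (n : ℕ) : B.alphaPow n =
    (∑ m : Option (Fin n), B.monPost (.pow n) m rfl
      (B.proj (n + 1) ((finSuccEquiv n).symm m))).hom := by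
  have hz (A : Weil) (f : Weil.pow n ⟶ A) : (B.base (n + 1) ≫ weilZero (Weil.pow n) B.M) ≫
      f ⊵ₗ B.M = B.base (n + 1) ≫ weilZero A B.M := by rw [Category.assoc, weilZero_map]
  -- For an arbitrary `f` the term of `1` stays the term of `1`, and that of `xᵢ` becomes the lift
  -- along `f(xᵢ)`.
  have key (A : Weil) (f : Weil.pow n ⟶ A) :
      (∑ m : Option (Fin n), B.monPost (.pow n) m rfl
        (B.proj (n + 1) ((finSuccEquiv n).symm m))).hom ≫ f ⊵ₗ B.E =
      (B.monPost A (.one A) rfl (B.proj (n + 1) 0) +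
        ∑ i : Fin n, B.evalPost A (f.hom (Weil.var i)) rfl (B.proj (n + 1) i.succ)).hom := by
    have : B.mapWeil f (hz A f) (∑ m : Option (Fin n), B.monPost (.pow n) m rfl
        (B.proj (n + 1) ((finSuccEquiv n).symm m))) =
        B.monPost A (.one A) rfl (B.proj (n + 1) 0) +
        ∑ i : Fin n, B.evalPost A (f.hom (Weil.var i)) rfl (B.proj (n + 1) i.succ) := by
      rw [map_sum, Fintype.sum_option]
      congr 1
      · refine (B.mapWeil_monPost f (.one _) rfl rfl (hz A f) _).trans ?_
        rw [Weil.basis_one, map_one, ← Weil.basis_one, evalPost_basis]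
        rfl
      · refine Finset.sum_congr rfl fun i _ => ?_
        refine (B.mapWeil_monPost f (.var i) rfl rfl (hz A f) _).trans ?_
        rw [Weil.basis_var]
        rfl
    exact congrArg Over.hom this
  refine (isPower_tangent n B.E).hom_ext ?_ fun j => ?_
  · rw [alphaPow_proj, tangentProj, ← Category.assoc, key, Finset.sum_eq_zero, add_zero,
      monPost_hom]
    · change _ = (_ ≫ (B.monLift (𝟙_ Weil) (.one _)).hom) ≫ _
      rw [monLift_one, weilZero_unit, Category.assoc, Iso.inv_hom_id, Category.comp_id]
      rfl
    · intro i _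
      rw [Weil.aug, Weil.desc_var, evalPost_zero]
  · rw [alphaPow_component, key, Finset.sum_eq_single j, alphaW_eq]
    · rw [Weil.proj, Weil.desc_var, if_pos rfl, ← Weil.basis_var, evalPost_basis]
      refine (B.weil Weil.W).comp_pair _ _ _ _ |> congrArg (· ≫ Weil.W ⊴ₗ B.σ) |>
        (Category.assoc _ _ _).symm.trans |>.trans ?_
      refine congrArg (· ≫ Weil.W ⊴ₗ B.σ) (pair_congr (B := B.weil Weil.W) ?_ ?_ _)
      · rw [monPost_hom, monPost_hom, ← Category.assoc]
        exact congrArg (· ≫ _) (B.pair_fst _ _ _)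
      · rw [monPost_hom, monPost_hom, ← Category.assoc]
        exact congrArg (· ≫ _) (B.pair_snd _ _ _)
    · intro i _ hi
      rw [Weil.proj, Weil.desc_var, if_neg hi, evalPost_zero]
    · simp

/-- The lineator, with its source and target written as powers. -/
def alpha (A : Weil) (k : NBullet) : B.pow (NBullet.act A k).dim ⟶ A ⊙ₗ B.pow k.dim :=
  B.alphaHat A k

lemma alpha_tensor_comp (A A' : Weil) (k : NBullet) {Y : X} (g : (A ⊗ A') ⊙ₗ B.pow k.dim ⟶ Y) :
    B.alpha (A ⊗ A') k ≫ g = B.alpha A (NBullet.act A' k) ≫ A ⊴ₗ B.alpha A' k ≫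
      (αₗ A A' (B.pow k.dim)).inv ≫ g :=
  (Category.assoc _ _ _).trans (congrArg (B.alpha A (NBullet.act A' k) ≫ ·) (Category.assoc _ _ _))

lemma alpha_tensor_hom (A A' : Weil) (k : NBullet) :
    B.alpha (A ⊗ A') k ≫ (αₗ A A' (B.pow k.dim)).hom =
      B.alpha A (NBullet.act A' k) ≫ A ⊴ₗ B.alpha A' k := by
  refine (B.alpha_tensor_comp A A' k _).trans (congrArg (B.alpha A (NBullet.act A' k) ≫ ·) ?_)
  rw [Iso.inv_hom_id, Category.comp_id]

lemma alpha_pow_π (n : ℕ) (k : NBullet) (i : Fin k.dim) :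
    B.alpha (.pow n) k ≫ Weil.pow n ⊴ₗ B.π k.dim i = B.block n k i ≫ B.alphaPow n :=
  (B.isPower_weil n k.dim).lift_π _ _ (B.block_alphaPow_q n k) i

lemma alpha_base : ∀ (A : Weil) (k : NBullet), B.alpha A k ≫ A ⊴ₗ B.base k.dim =
    B.base (NBullet.act A k).dim ≫ weilZero A B.M
  | .unit, k => by
    have h := actionUnitIso_inv_naturality (C := Weil) (B.base k.dim)
    rw [← weilZero_unit B.M] at h
    exact h
  | .pow n, k => (B.isPower_weil n k.dim).lift_base _ _ (B.block_alphaPow_q n k)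
  | .tensor A A', k => by
    have h : B.alpha A (NBullet.act A' k) ≫ A ⊴ₗ B.alpha A' k ≫ (αₗ A A' (B.pow k.dim)).inv ≫
        (A ⊗ A') ⊴ₗ B.base k.dim = B.base (NBullet.act A (NBullet.act A' k)).dim ≫
        weilZero (A ⊗ A') B.M := by
      rw [actionAssoc_inv_naturality, ← actionHomRight_comp_assoc, alpha_base A',
        actionHomRight_comp, Category.assoc, ← Category.assoc, alpha_base A, Category.assoc,
        weilZero_tensor]
    exact (B.alpha_tensor_comp A A' k _).trans h

/-- The sum over `A'` is outermost because `T_A` is applied to a sum over the monomials of `A'`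
already present. -/
lemma sum_mon_tensor {A A' : Weil} {S : Type*} [AddCommMonoid S] (f : (A ⊗ A').Mon → S) :
    ∑ p, f p = ∑ a' : A'.Mon, ∑ a : A.Mon, f (a.pair a') :=
  Fintype.sum_prod_type_right _

/-- This turns the inductive definition into a closed formula. In the tensor case `T_A` distributes
over the sum for `A'`, the formula for `A` expands each coordinate once more, and lifts along `a`
and `a'` compose to the lift along `a ⊗ a'`. -/
lemma alpha_π : ∀ (A : Weil) (k : NBullet) (i : Fin k.dim), B.alpha A k ≫ A ⊴ₗ B.π k.dim i =
    (∑ m, B.monPost A m rfl (B.proj _ (NBullet.index A k (m, i)))).hom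
  | .unit, k, i => by
    have h := actionUnitIso_inv_naturality (C := Weil) (B.π k.dim i)
    rw [← weilZero_unit B.E, ← monLift_one] at h
    refine h.trans ?_
    exact congrArg Over.hom (Fintype.sum_unique (ι := Unit) fun m =>
      B.monPost .unit m rfl (B.proj _ (NBullet.index .unit k (m, i)))).symm
  | .pow n, k, i => by
    rw [alpha_pow_π, alphaPow_eq]
    have hb : B.block n k i ≫ B.base (n + 1) = B.base (NBullet.act (.pow n) k).dim :=
      B.lift_base _ _ _
    have : Over.precomp (B.weil_additive (.pow n)) (B.block n k i)
        (c := B.base (NBullet.act (.pow n) k).dim ≫ weilZero (.pow n) B.M)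
        (by rw [← Category.assoc, hb])
        (∑ m : Option (Fin n), B.monPost (.pow n) m rfl
          (B.proj (n + 1) ((finSuccEquiv n).symm m))) =
        ∑ m : Option (Fin n), B.monPost (.pow n) m rfl
          (B.proj _ (NBullet.index (.pow n) k (m, i))) := by
      rw [map_sum]
      refine Finset.sum_congr rfl fun m _ => ?_
      rw [B.precomp_monPost (.pow n) m rfl _ _ hb _ rfl]
      congr 1
      refine Subtype.ext ((B.lift_π _ _ _ _).trans ?_)
      rw [Equiv.apply_symm_apply]
      rfl
    exact congrArg Over.hom this
  | .tensor A A', k, i => by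
    have hb := B.alpha_base A (NBullet.act A' k)
    have hπ : B.alpha A (NBullet.act A' k) ≫ A ⊴ₗ B.alpha A' k ≫ (αₗ A A' (B.pow k.dim)).inv ≫
        (A ⊗ A') ⊴ₗ B.π k.dim i = B.alpha A (NBullet.act A' k) ≫
        A ⊴ₗ (∑ m, B.monPost A' m rfl (B.proj _ (NBullet.index A' k (m, i)))).hom ≫
        (αₗ A A' B.E).inv := by
      rw [actionAssoc_inv_naturality, ← actionHomRight_comp_assoc, alpha_π A' k i]
    have hc : B.alpha A (NBullet.act A' k) ≫ A ⊴ₗ (B.base (NBullet.act A' k).dim ≫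
        weilZero A' B.M) ≫ (αₗ A A' B.M).inv =
        B.base (NBullet.act A (NBullet.act A' k)).dim ≫ weilZero (A ⊗ A') B.M := by
      rw [actionHomRight_comp, Category.assoc, ← Category.assoc, hb, Category.assoc,
        weilZero_tensor]
    have hd : (B.base (NBullet.act A (NBullet.act A' k)).dim ≫ weilZero A B.M) ≫
        A ⊴ₗ weilZero A' B.M ≫ (αₗ A A' B.M).inv =
        B.base (NBullet.act A (NBullet.act A' k)).dim ≫ weilZero (A ⊗ A') B.M := by
      rw [Category.assoc, weilZero_tensor]
    have key (a' : A'.Mon) : Over.precomp (B.weil_additive (A ⊗ A'))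
        (B.alpha A (NBullet.act A' k)) hc (B.tensorMap A (B.monPost A' a' rfl
          (B.proj _ (NBullet.index A' k (a', i))))) =
        ∑ a : A.Mon, B.monPost (A ⊗ A') (a.pair a') rfl
          (B.proj _ (NBullet.index A (NBullet.act A' k) (a, NBullet.index A' k (a', i)))) := by
      -- The lift along `a'` is additive, and so is its image under `T_A`; it can thus be pulled out
      -- of the sum over the monomials of `A`.
      have e : Over.precomp (B.weil_additive (A ⊗ A')) (B.alpha A (NBullet.act A' k)) hc
          (B.tensorMap A (B.monPost A' a' rfl (B.proj _ (NBullet.index A' k (a', i))))) =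
          Over.postcomp (B.weil_additive (A ⊗ A'))
            (B.isAdditiveMorphism_tensor A (B.isAdditiveMorphism_monLift A' a')) hd
            (∑ a : A.Mon, B.monPost A a rfl
              (B.proj _ (NBullet.index A (NBullet.act A' k) (a, NBullet.index A' k (a', i))))) := by
        refine Over.ext ?_
        rw [Over.postcomp_hom, ← alpha_π A, Over.precomp_hom]
        change _ ≫ A ⊴ₗ (B.π _ _ ≫ _) ≫ _ = _
        rw [actionHomRight_comp, Category.assoc, Category.assoc]
      rw [e, map_sum]
      refine Finset.sum_congr rfl fun a _ => Over.ext ?_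
      rw [Over.postcomp_hom, monPost_hom, monPost_hom, Category.assoc, monLift_pair]
    have : Over.precomp (B.weil_additive (A ⊗ A')) (B.alpha A (NBullet.act A' k)) hc
        (B.tensorMap A (∑ a', B.monPost A' a' rfl (B.proj _ (NBullet.index A' k (a', i))))) =
        ∑ a', ∑ a, B.monPost (A ⊗ A') (a.pair a') rfl
          (B.proj _ (NBullet.index A (NBullet.act A' k) (a, NBullet.index A' k (a', i)))) := by
      rw [map_sum, map_sum]
      exact Finset.sum_congr rfl fun a' _ => key a'
    exact (B.alpha_tensor_comp A A' k _).trans (hπ.trans ((congrArg Over.hom this).trans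
      (congrArg Over.hom (sum_mon_tensor fun p => B.monPost (A ⊗ A') p rfl
        (B.proj _ (NBullet.index (A ⊗ A') k (p, i)))).symm)))

/-! ### Naturality of the lineator -/

lemma linComb_index {A : Weil} {k : NBullet} {n : ℕ}
    (C : Matrix (Fin n) (Fin (NBullet.act A k).dim) ℕ) (i : Fin n) :
    B.linComb C i = ∑ m, ∑ j, C i (NBullet.index A k (m, j)) •
      B.proj _ (NBullet.index A k (m, j)) := by
  rw [linComb, ← (NBullet.index A k).sum_comp, Fintype.sum_prod_type]

lemma matrixMap_alpha_π {A : Weil} {k : NBullet} {n : ℕ}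
    (C : Matrix (Fin (NBullet.act A k).dim) (Fin n) ℕ) (i : Fin k.dim) :
    B.matrixMap C ≫ B.alpha A k ≫ A ⊴ₗ B.π k.dim i =
      (∑ m, B.monPost A m rfl (B.linComb C (NBullet.index A k (m, i)))).hom := by
  have : Over.precomp (B.weil_additive A) (B.matrixMap C)
      (c := B.base n ≫ weilZero A B.M) (by rw [← Category.assoc, matrixMap_base])
      (∑ m, B.monPost A m rfl (B.proj _ (NBullet.index A k (m, i)))) =
      ∑ m, B.monPost A m rfl (B.linComb C (NBullet.index A k (m, i))) := by
    rw [map_sum]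
    refine Finset.sum_congr rfl fun m _ => ?_
    rw [B.precomp_monPost A m rfl _ _ (B.matrixMap_base C) _ rfl, matrixMap_proj]
  rw [alpha_π]
  exact congrArg Over.hom this

/-- In coordinates, the map induced by `f` replaces the lift along `m` by the lift along `f(m)`.
Expanding `f(m)` in monomials produces the entries of the matrix of `f`, which are the coefficients
on the other side. -/
lemma alpha_naturality_left {A A' : Weil} (f : A ⟶ A') (k : NBullet) :
    B.matrixMap (NBullet.actMap f (𝟙 k)).mat ≫ B.alpha A' k = B.alpha A k ≫ f ⊵ₗ B.pow k.dim := by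
  refine (B.weil A').hom_ext ?_ fun i => ?_
  · rw [Category.assoc, Category.assoc, alpha_base, ← action_exchange, ← Category.assoc,
      ← Category.assoc, alpha_base, matrixMap_base, Category.assoc, weilZero_map]
  · rw [Category.assoc, Category.assoc, matrixMap_alpha_π, ← action_exchange, ← Category.assoc,
      alpha_π]
    have : B.mapWeil f (c' := B.base (NBullet.act A k).dim ≫ weilZero A' B.M)
        (by rw [Category.assoc, weilZero_map])
        (∑ m, B.monPost A m rfl (B.proj _ (NBullet.index A k (m, i)))) =
        ∑ m', B.monPost A' m' rfl (B.linComb (NBullet.actMap f (𝟙 k)).mat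
          (NBullet.index A' k (m', i))) := by
      rw [map_sum]
      simp only [B.mapWeil_monPost f _ rfl rfl, evalPost_apply]
      rw [Finset.sum_comm]
      refine Finset.sum_congr rfl fun m' _ => ?_
      rw [linComb_index, map_sum]
      refine Finset.sum_congr rfl fun m _ => ?_
      -- The Kronecker factor `𝟙 k` leaves only the coordinates with the same index `i`.
      rw [Finset.sum_eq_single i, map_nsmul, NBullet.actMap_mat, NBullet.id_mat, if_pos rfl,
        mul_one, Weil.mat_apply]
      · intro j _ hj
        rw [NBullet.actMap_mat, NBullet.id_mat, if_neg hj.symm, mul_zero, zero_smul]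
      · simp
    exact congrArg Over.hom this.symm

/-- Both the lifts and the action of `T_A` on morphisms over `M` are additive, so each side is the
same double sum, over the monomials of `A` and over a row of `g`. -/
lemma alpha_naturality_right (A : Weil) {k l : NBullet} (g : k ⟶ l) :
    B.matrixMap (NBullet.actMap (𝟙 A) g).mat ≫ B.alpha A l =
      B.alpha A k ≫ A ⊴ₗ B.matrixMap g.mat := by
  refine (B.weil A).hom_ext ?_ fun i => ?_
  · rw [Category.assoc, Category.assoc, alpha_base, ← actionHomRight_comp, matrixMap_base,
      alpha_base, ← Category.assoc, matrixMap_base]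
  · rw [Category.assoc, Category.assoc, matrixMap_alpha_π, ← actionHomRight_comp, matrixMap_π]
    have : Over.precomp (B.weil_additive A) (B.alpha A k) (B.alpha_base A k)
        (B.weilMap A _ (B.linComb g.mat i)) =
        ∑ m, B.monPost A m rfl (B.linComb (NBullet.actMap (𝟙 A) g).mat
          (NBullet.index A l (m, i))) := by
      have e (j : Fin k.dim) : Over.precomp (B.weil_additive A) (B.alpha A k) (B.alpha_base A k)
          (B.weilMap A _ (B.proj _ j)) =
          ∑ m, B.monPost A m rfl (B.proj _ (NBullet.index A k (m, j))) :=
        Over.ext (B.alpha_π A k j)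
      rw [linComb, map_sum, map_sum]
      simp only [map_nsmul, e, Finset.smul_sum]
      rw [Finset.sum_comm]
      refine Finset.sum_congr rfl fun m _ => ?_
      rw [linComb_index, map_sum, Finset.sum_eq_single m, map_sum]
      · refine Finset.sum_congr rfl fun j _ => ?_
        rw [map_nsmul, NBullet.actMap_mat, Weil.mat_id, Matrix.one_apply_eq, one_mul]
      · intro m' _ hm
        refine (congrArg _ (Finset.sum_eq_zero fun j _ => ?_)).trans (map_zero _)
        rw [NBullet.actMap_mat, Weil.mat_id, Matrix.one_apply_ne hm.symm, zero_mul, zero_smul]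
      · simp
    exact congrArg Over.hom this.symm

/-- `(F_E, α)` is an oplax linear functor. -/
abbrev oplaxLinear : B.functor.OplaxLeftLinear Weil where
  δₗ := B.alphaHat
  δₗ_naturality_left f k := B.alpha_naturality_left f k
  δₗ_naturality_right A _ _ g := B.alpha_naturality_right A g
  δₗ_associativity A A' k := by
    -- The associativity isomorphism of `ℕ^•` is an identity, so its image under the functor drops
    -- out.
    refine Eq.trans ?_ ((congrArg (· ≫ _) (B.functor.map_id _)).trans (Category.id_comp _)).symm
    exact B.alpha_tensor_hom A A' k
  δₗ_unitality_inv k :=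
    ((congrArg (· ≫ _) (B.functor.map_id _)).trans (Category.id_comp _)).symm

end DifferentialBundle

/-! ### The lineator is Cartesian -/

namespace DifferentialBundle

open BundleData

variable {X : Type u} [Category.{v} X] [MonoidalLeftAction Weil X] [IsTangentActegory X]
  (B : DifferentialBundle X)

/-- The symmetry of `E₂`. -/
def swap : B.pow 2 ⟶ B.pow 2 := B.pair (B.π 2 1) (B.π 2 0) (by rw [B.π_q, B.π_q])

lemma swap_base : B.swap ≫ B.base 2 = B.base 2 := by
  rw [swap, B.pair_base, B.π_q]

lemma swap_fst : B.swap ≫ B.π 2 0 = B.π 2 1 := B.pair_fst _ _ _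

lemma swap_snd : B.swap ≫ B.π 2 1 = B.π 2 0 := B.pair_snd _ _ _

lemma swap_swap : B.swap ≫ B.swap = 𝟙 _ := by
  refine B.hom_ext ?_ (Fin.forall_fin_two.2 ⟨?_, ?_⟩)
  · rw [Category.assoc, swap_base, swap_base, Category.id_comp]
  · rw [Category.assoc, swap_fst, swap_snd, Category.id_comp]
  · rw [Category.assoc, swap_snd, swap_fst, Category.id_comp]

instance : IsIso B.swap := ⟨B.swap, B.swap_swap, B.swap_swap⟩

/-- The lineator places the zero before `λ`, and the universality axiom places `λ` first;
commutativity of `σ` bridges the two conventions. -/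
lemma alphaW_eq_swap :
    B.alphaW = B.swap ≫ B.liftThenZero B.preserved B.lam B.lam_q := by
  have h1 : B.swap ≫ B.σ = B.σ := B.additive.comm
  have h2 : B.zeroAndLift B.preserved B.lam B.lam_q ≫ Weil.W ⊴ₗ B.swap =
      B.swap ≫ (B.tangent B.preserved).pair (B.π 2 0 ≫ B.lam) (B.π 2 1 ≫ weilZero Weil.W B.E)
        (B.lift_compat B.lam B.lam_q 0 1) := by
    refine Eq.trans ?_ ((B.tangent B.preserved).comp_pair _ _ _ _).symm
    refine (pair_eq (B := B.tangent B.preserved) ?_ ?_).symm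
    · change (_ ≫ Weil.W ⊴ₗ _) ≫ Weil.W ⊴ₗ B.π 2 0 = _
      rw [Category.assoc, ← actionHomRight_comp, swap_fst, B.zeroAndLift_snd]
      exact (congrArg (· ≫ B.lam) B.swap_fst.symm).trans (Category.assoc _ _ _)
    · change (_ ≫ Weil.W ⊴ₗ _) ≫ Weil.W ⊴ₗ B.π 2 1 = _
      rw [Category.assoc, ← actionHomRight_comp, swap_snd, B.zeroAndLift_fst]
      exact (congrArg (· ≫ weilZero Weil.W B.E) B.swap_snd.symm).trans (Category.assoc _ _ _)
  have h3 : B.alphaW = (B.zeroAndLift B.preserved B.lam B.lam_q ≫ Weil.W ⊴ₗ B.swap) ≫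
      Weil.W ⊴ₗ B.σ := by
    rw [Category.assoc, ← actionHomRight_comp, h1]; rfl
  refine h3.trans ?_
  exact (congrArg (· ≫ Weil.W ⊴ₗ B.σ) h2).trans (Category.assoc _ _ _)

lemma isPullback_alphaW (C : Weil) : IsPullback (C ⊴ₗ B.alphaW) (C ⊴ₗ B.base 2)
    (C ⊴ₗ Weil.W ⊴ₗ B.q) (C ⊴ₗ weilZero Weil.W B.M) := by
  have h := isPullback_weil B.universality C
  have h' : IsPullback (C ⊴ₗ B.swap) (C ⊴ₗ B.base 2) (C ⊴ₗ B.base 2) (𝟙 (C ⊙ₗ B.M)) :=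
    .of_horiz_isIso ⟨by rw [← actionHomRight_comp, swap_base, Category.comp_id]⟩
  have := h'.paste_horiz h
  rwa [← actionHomRight_comp, ← alphaW_eq_swap, Category.id_comp] at this

/-! ### The lineator of `Wⁿ` is Cartesian over the base -/

lemma alpha_pow_tangentProj (n : ℕ) (k : NBullet) (i : Fin k.dim) :
    B.alpha (.pow n) k ≫ Weil.pow n ⊴ₗ B.π k.dim i ≫ tangentProj n B.E =
      B.π _ (NBullet.index (.pow n) k (.one _, i)) := by
  rw [← Category.assoc, alpha_pow_π, Category.assoc, alphaPow_proj]
  refine (B.lift_π _ _ _ _).trans ?_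
  rw [finSuccEquiv_zero]; rfl

/-- The projection onto the coordinates of `1` and `xⱼ`. -/
def twoCoords (n : ℕ) (k : NBullet) (i : Fin k.dim) (j : Fin n) :
    B.pow (NBullet.act (.pow n) k).dim ⟶ B.pow 2 :=
  B.pair (B.π _ (NBullet.index (.pow n) k (.one _, i)))
    (B.π _ (NBullet.index (.pow n) k (.var j, i))) (by rw [B.π_q, B.π_q])

lemma twoCoords_base (n : ℕ) (k : NBullet) (i : Fin k.dim) (j : Fin n) :
    B.twoCoords n k i j ≫ B.base 2 = B.base _ := by
  rw [twoCoords, B.pair_base, B.π_q]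

lemma twoCoords_fst (n : ℕ) (k : NBullet) (i : Fin k.dim) (j : Fin n) :
    B.twoCoords n k i j ≫ B.π 2 0 = B.π _ (NBullet.index (.pow n) k (.one _, i)) :=
  B.pair_fst _ _ _

lemma twoCoords_snd (n : ℕ) (k : NBullet) (i : Fin k.dim) (j : Fin n) :
    B.twoCoords n k i j ≫ B.π 2 1 = B.π _ (NBullet.index (.pow n) k (.var j, i)) :=
  B.pair_snd _ _ _

lemma alpha_pow_component (n : ℕ) (k : NBullet) (i : Fin k.dim) (j : Fin n) :
    B.alpha (.pow n) k ≫ Weil.pow n ⊴ₗ B.π k.dim i ≫ Weil.proj j ⊵ₗ B.E =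
      B.twoCoords n k i j ≫ B.alphaW := by
  rw [← Category.assoc, alpha_pow_π, Category.assoc, alphaPow_component, ← Category.assoc]
  congr 1
  rw [B.comp_pair]
  refine pair_congr ((B.lift_π _ _ _ _).trans ?_) ((B.lift_π _ _ _ _).trans ?_) _
  · rw [finSuccEquiv_zero]; rfl
  · rw [finSuccEquiv_succ]; rfl

/-- A morphism into `T_C T_n E_k` lying over the zero of `T_n M` is a family of morphisms into `T_C
T E`, one for each coordinate `i` and generator `xⱼ`. Universality of `λ` turns each into a pair
over `M`. The first entry depends on `i` alone, so the pairs assemble into one tuple indexed by `1,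
x₁, …, xₙ` and `i`. -/
lemma isPullback_alpha_pow (n : ℕ) (k : NBullet) (C : Weil) :
    IsPullback (C ⊴ₗ B.alpha (.pow n) k) (C ⊴ₗ B.base (NBullet.act (.pow n) k).dim)
      (C ⊴ₗ Weil.pow n ⊴ₗ B.base k.dim) (C ⊴ₗ weilZero (.pow n) B.M) := by
  have powE (m : ℕ) : IsPullbackPower (C ⊴ₗ B.q) (C ⊴ₗ B.base m) (fun i => C ⊴ₗ B.π m i) :=
    isPullbackPower_weil (fun k => B.preserved k m) C
  have powTE : IsPullbackPower (C ⊴ₗ Weil.pow n ⊴ₗ B.q) (C ⊴ₗ Weil.pow n ⊴ₗ B.base k.dim)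
      (fun i => C ⊴ₗ Weil.pow n ⊴ₗ B.π k.dim i) :=
    isPullbackPower_map_of_iso (weilFunctorTensorIso X C (.pow n)).symm
      (isPullbackPower_weil (fun l => B.preserved l k.dim) (.tensor C (.pow n)))
  have fnd (Z : X) : IsPullbackPower (C ⊴ₗ tangentProj 1 Z) (C ⊴ₗ tangentProj n Z)
      (fun j : Fin n => C ⊴ₗ Weil.proj j ⊵ₗ Z) :=
    isPullbackPower_weil (fun l => IsTangentActegory.foundational l n Z) C
  have uni := B.isPullback_alphaW C
  have hp (i : Fin k.dim) : C ⊴ₗ B.alpha (.pow n) k ≫ C ⊴ₗ Weil.pow n ⊴ₗ B.π k.dim i ≫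
      C ⊴ₗ tangentProj n B.E = C ⊴ₗ B.π _ (NBullet.index (.pow n) k (.one _, i)) := by
    rw [← B.alpha_pow_tangentProj n k i, actionHomRight_comp, actionHomRight_comp]
  have hj (i : Fin k.dim) (j : Fin n) : C ⊴ₗ B.alpha (.pow n) k ≫
      C ⊴ₗ Weil.pow n ⊴ₗ B.π k.dim i ≫ C ⊴ₗ Weil.proj j ⊵ₗ B.E =
      C ⊴ₗ B.twoCoords n k i j ≫ C ⊴ₗ B.alphaW := by
    rw [← actionHomRight_comp C (B.twoCoords n k i j), ← B.alpha_pow_component n k i j,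
      actionHomRight_comp, actionHomRight_comp]
  have hb : C ⊴ₗ B.alpha (.pow n) k ≫ C ⊴ₗ Weil.pow n ⊴ₗ B.base k.dim =
      C ⊴ₗ B.base (NBullet.act (.pow n) k).dim ≫ C ⊴ₗ weilZero (.pow n) B.M := by
    rw [← actionHomRight_comp, alpha_base, actionHomRight_comp]
  refine isPullback_iff_isPowerAlong.2 ⟨fun _ => hb, fun {Z} c f hf => ?_, fun {Z} f g h1 h2 => ?_⟩
  · obtain ⟨u, rfl⟩ : ∃ u, f = fun _ => u := ⟨f (), rfl⟩
    replace hf := hf ()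
    have hq (i : Fin k.dim) : u ≫ C ⊴ₗ Weil.pow n ⊴ₗ B.π k.dim i ≫ C ⊴ₗ Weil.pow n ⊴ₗ B.q =
        c ≫ C ⊴ₗ weilZero (.pow n) B.M := by
      rw [← actionHomRight_comp, ← actionHomRight_comp, B.π_q, hf]
    have ht (i : Fin k.dim) (j : Fin n) : (u ≫ C ⊴ₗ Weil.pow n ⊴ₗ B.π k.dim i ≫
        C ⊴ₗ Weil.proj j ⊵ₗ B.E) ≫ C ⊴ₗ Weil.W ⊴ₗ B.q = c ≫ C ⊴ₗ weilZero Weil.W B.M := by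
      rw [Category.assoc, Category.assoc, ← actionHomRight_comp C (Weil.proj j ⊵ₗ B.E),
        ← weilProj_naturality, actionHomRight_comp, ← Category.assoc, ← Category.assoc,
        Category.assoc u, hq, Category.assoc, ← actionHomRight_comp, weilZero_map]
    have hd (i : Fin k.dim) : (u ≫ C ⊴ₗ Weil.pow n ⊴ₗ B.π k.dim i ≫
        C ⊴ₗ tangentProj n B.E) ≫ C ⊴ₗ B.q = c := by
      rw [Category.assoc, Category.assoc, ← actionHomRight_comp C (tangentProj n B.E),
        ← tangentProj_naturality, actionHomRight_comp, ← Category.assoc, ← Category.assoc,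
        Category.assoc u, hq, Category.assoc, ← actionHomRight_comp, weilZero_proj,
        actionHomRight_id, Category.comp_id]
    let e (i : Fin k.dim) (j : Fin n) := uni.lift _ _ (ht i j)
    have e1 (i : Fin k.dim) (j : Fin n) : e i j ≫ C ⊴ₗ B.alphaW = _ := uni.lift_fst _ _ (ht i j)
    have e2 (i : Fin k.dim) (j : Fin n) : e i j ≫ C ⊴ₗ B.base 2 = c := uni.lift_snd _ _ (ht i j)
    -- The lineator of `W` lies over the first projection, so the first entry is the projection to
    -- `E` and does not depend on `j`.
    have e0 (i : Fin k.dim) (j : Fin n) : e i j ≫ C ⊴ₗ B.π 2 0 =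
        u ≫ C ⊴ₗ Weil.pow n ⊴ₗ B.π k.dim i ≫ C ⊴ₗ tangentProj n B.E := by
      rw [← alphaW_proj, actionHomRight_comp, ← Category.assoc, e1, Category.assoc,
        Category.assoc, (fnd B.E).w j]
    -- The coordinate of `1` is read off `T_n E → E` directly, not from some pair `e i j`, since
    -- there is no `j` when `n = 0`.
    let comp (p : Option (Fin n) × Fin k.dim) : Z ⟶ C ⊙ₗ B.E :=
      p.1.elim (u ≫ C ⊴ₗ Weil.pow n ⊴ₗ B.π k.dim p.2 ≫ C ⊴ₗ tangentProj n B.E)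
        fun j => e p.2 j ≫ C ⊴ₗ B.π 2 1
    have hcomp (p) : comp p ≫ C ⊴ₗ B.q = c := by
      obtain ⟨_ | j, i⟩ := p
      · exact hd i
      · change (e i j ≫ _) ≫ _ = _
        rw [Category.assoc, ← actionHomRight_comp, B.π_q, e2]
    let v := (powE (NBullet.act (.pow n) k).dim).lift c
      (fun x => comp ((NBullet.index (.pow n) k).symm x)) fun x => hcomp _
    have hv (m : (Weil.pow n).Mon) (i : Fin k.dim) :
        v ≫ C ⊴ₗ B.π _ (NBullet.index (.pow n) k (m, i)) = comp (m, i) :=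
      ((powE _).lift_π _ _ _ _).trans (by rw [Equiv.symm_apply_apply])
    have hvb : v ≫ C ⊴ₗ B.base _ = c := (powE _).lift_base _ _ _
    have hve (i : Fin k.dim) (j : Fin n) : v ≫ C ⊴ₗ B.twoCoords n k i j = e i j := by
      refine (powE 2).hom_ext ?_ (Fin.forall_fin_two.2 ⟨?_, ?_⟩)
      · rw [Category.assoc, ← actionHomRight_comp, twoCoords_base, hvb, e2]
      · rw [Category.assoc, ← actionHomRight_comp, twoCoords_fst, hv, e0]; rfl
      · rw [Category.assoc, ← actionHomRight_comp, twoCoords_snd, hv]; rfl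
    refine ⟨v, hvb, fun _ => powTE.hom_ext ?_ fun i => (fnd B.E).hom_ext ?_ fun j => ?_⟩
    · rw [Category.assoc, hb, ← Category.assoc, hvb, hf]
    · rw [Category.assoc, Category.assoc, Category.assoc, hp, hv]; rfl
    · rw [Category.assoc, Category.assoc, Category.assoc, hj, ← Category.assoc, hve, e1]
  · replace h2 := h2 ()
    have h3 (i : Fin k.dim) (j : Fin n) : f ≫ C ⊴ₗ B.twoCoords n k i j =
        g ≫ C ⊴ₗ B.twoCoords n k i j := by
      refine uni.hom_ext ?_ ?_
      · rw [Category.assoc, Category.assoc, ← hj, ← Category.assoc, h2, Category.assoc]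
      · rw [Category.assoc, Category.assoc, ← actionHomRight_comp, twoCoords_base, h1]
    refine (powE _).hom_ext h1 fun x => ?_
    obtain ⟨⟨_ | j, i⟩, rfl⟩ := (NBullet.index (.pow n) k).surjective x
    · exact (congrArg (f ≫ ·) (hp i).symm).trans ((Category.assoc _ _ _).symm.trans
        ((congrArg (· ≫ _) h2).trans ((Category.assoc _ _ _).trans (congrArg (g ≫ ·) (hp i)))))
    · have h4 := congrArg (· ≫ C ⊴ₗ B.π 2 1) (h3 i j)
      simp only [Category.assoc, ← actionHomRight_comp, twoCoords_snd] at h4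
      exact h4

/-- The outer `C` is what makes the induction close: for `A ⊗ A'` the square of `A'` is needed after
applying `T_C T_A`, that is, for `C ⊗ A`. It is pasted to the square of `A` and to an associativity
square with invertible sides. -/
lemma isPullback_alpha_base : ∀ (A : Weil) (k : NBullet) (C : Weil),
    IsPullback (C ⊴ₗ B.alpha A k) (C ⊴ₗ B.base (NBullet.act A k).dim)
      (C ⊴ₗ A ⊴ₗ B.base k.dim) (C ⊴ₗ weilZero A B.M)
  | .unit, k, C => by
    have : IsIso (weilZero .unit B.M) := by
      change IsIso (weilZero (𝟙_ Weil) B.M)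
      rw [weilZero_unit]; infer_instance
    have : IsIso (B.alpha .unit k) := inferInstanceAs (IsIso (λₗ[Weil] (B.pow k.dim)).inv)
    exact .of_horiz_isIso ⟨by
      rw [← actionHomRight_comp, alpha_base, actionHomRight_comp]⟩
  | .pow n, k, C => B.isPullback_alpha_pow n k C
  | .tensor A A', k, C => by
    have s := isPullback_alpha_base A (NBullet.act A' k) C
    have t : IsPullback (C ⊴ₗ A ⊴ₗ B.alpha A' k) (C ⊴ₗ A ⊴ₗ B.base (NBullet.act A' k).dim)
        (C ⊴ₗ A ⊴ₗ A' ⊴ₗ B.base k.dim) (C ⊴ₗ A ⊴ₗ weilZero A' B.M) :=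
      isPullback_map_of_iso (weilFunctorTensorIso X C A).symm
        (isPullback_alpha_base A' k (.tensor C A))
    have r : IsPullback (C ⊴ₗ (αₗ A A' (B.pow k.dim)).inv) (C ⊴ₗ A ⊴ₗ A' ⊴ₗ B.base k.dim)
        (C ⊴ₗ (A ⊗ A') ⊴ₗ B.base k.dim) (C ⊴ₗ (αₗ A A' B.M).inv) :=
      .of_horiz_isIso ⟨by
        rw [← actionHomRight_comp, actionAssoc_inv_naturality, actionHomRight_comp]⟩
    have := s.paste_horiz (t.paste_horiz r)
    rw [← actionHomRight_comp, ← actionHomRight_comp, ← actionHomRight_comp,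
      ← actionHomRight_comp, weilZero_tensor] at this
    exact this

/-- Matrix maps preserve the base, so a naturality square stacked on the base square of `l` is the
base square of `k`. Both base squares being pullbacks, the naturality square is one by cancellation.
-/
lemma isPullback_alpha (A : Weil) {k l : NBullet} (f : k ⟶ l) :
    IsPullback (B.alpha A k) (B.matrixMap (NBullet.actMap (𝟙 A) f).mat)
      (A ⊴ₗ B.matrixMap f.mat) (B.alpha A l) := by
  have h (m : NBullet) : IsPullback (B.alpha A m) (B.base (NBullet.act A m).dim)
      (A ⊴ₗ B.base m.dim) (weilZero A B.M) :=
    isPullback_map_of_iso (weilFunctorUnitIso X).symm (B.isPullback_alpha_base A m .unit)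
  refine .of_bot ?_ (B.alpha_naturality_right A f).symm (h l)
  rw [matrixMap_base, ← actionHomRight_comp, matrixMap_base]
  exact h k

/-! ### Preservation of pullbacks over the terminal object -/

/-- The action of a matrix on tuples. -/
def _root_.Matrix.smulTuple {S : Type*} [AddCommMonoid S] {m n : ℕ}
    (C : Matrix (Fin n) (Fin m) ℕ) (x : Fin m → S) : Fin n → S :=
  fun i => ∑ j, C i j • x j

section

variable {S : Type*} [AddCommMonoid S] {l m n : ℕ}

lemma mul_smulTuple (C : Matrix (Fin n) (Fin m) ℕ) (D : Matrix (Fin m) (Fin l) ℕ)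
    (x : Fin l → S) : (C * D).smulTuple x = C.smulTuple (D.smulTuple x) := by
  funext i
  simp only [Matrix.smulTuple, Matrix.mul_apply, Finset.sum_smul, Finset.smul_sum, smul_smul]
  exact Finset.sum_comm

lemma one_smulTuple (x : Fin m → S) : (1 : Matrix (Fin m) (Fin m) ℕ).smulTuple x = x := by
  funext i
  rw [Matrix.smulTuple, Finset.sum_eq_single i]
  · rw [Matrix.one_apply_eq, one_smul]
  · intro j _ hj
    rw [Matrix.one_apply_ne hj.symm, zero_smul]
  · simp

lemma zero_smulTuple (x : Fin m → S) : (0 : Matrix (Fin n) (Fin m) ℕ).smulTuple x = 0 := by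
  funext i
  simp [Matrix.smulTuple]

lemma add_smulTuple (C D : Matrix (Fin n) (Fin m) ℕ) (x : Fin m → S) :
    (C + D).smulTuple x = C.smulTuple x + D.smulTuple x := by
  funext i
  simp [Matrix.smulTuple, add_smul, Finset.sum_add_distrib]

lemma smulTuple_add (C : Matrix (Fin n) (Fin m) ℕ) (x y : Fin m → S) :
    C.smulTuple (x + y) = C.smulTuple x + C.smulTuple y := by
  funext i
  simp [Matrix.smulTuple, Finset.sum_add_distrib]

end

/-- The coordinates of a morphism into `T_A (Eₙ)`. -/
def coords (A : Weil) {n : ℕ} {Z : X} {c : Z ⟶ A ⊙ₗ B.M} (u : Z ⟶ A ⊙ₗ B.pow n)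
    (h : u ≫ A ⊴ₗ B.base n = c) (i : Fin n) : B.WeilOver A c :=
  ⟨u ≫ A ⊴ₗ B.π n i, by rw [Category.assoc, ← actionHomRight_comp, B.π_q, h]⟩

lemma coords_injective (A : Weil) {n : ℕ} {Z : X} {c : Z ⟶ A ⊙ₗ B.M} {u u' : Z ⟶ A ⊙ₗ B.pow n}
    {h : u ≫ A ⊴ₗ B.base n = c} {h' : u' ≫ A ⊴ₗ B.base n = c}
    (e : B.coords A u h = B.coords A u' h') : u = u' :=
  (B.weil A).hom_ext (h.trans h'.symm) fun i => congrArg Over.hom (congrFun e i)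

lemma exists_coords_eq (A : Weil) {n : ℕ} {Z : X} {c : Z ⟶ A ⊙ₗ B.M}
    (x : Fin n → B.WeilOver A c) : ∃ u, ∃ h : u ≫ A ⊴ₗ B.base n = c, B.coords A u h = x :=
  ⟨(B.weil A).lift c (fun i => (x i).hom) fun i => (x i).hom_q, (B.weil A).lift_base _ _ _,
    funext fun i => Over.ext ((B.weil A).lift_π _ _ _ i)⟩

lemma matrixMap_weil_base (A : Weil) {m n : ℕ} (C : Matrix (Fin n) (Fin m) ℕ) {Z : X}
    {c : Z ⟶ A ⊙ₗ B.M} {u : Z ⟶ A ⊙ₗ B.pow m} (h : u ≫ A ⊴ₗ B.base m = c) :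
    (u ≫ A ⊴ₗ B.matrixMap C) ≫ A ⊴ₗ B.base n = c := by
  rw [Category.assoc, ← actionHomRight_comp, matrixMap_base, h]

/-- `T_A` acts additively on morphisms over `M`, so it commutes with the linear combinations that
define the matrix map. -/
lemma coords_matrixMap (A : Weil) {m n : ℕ} (C : Matrix (Fin n) (Fin m) ℕ) {Z : X}
    {c : Z ⟶ A ⊙ₗ B.M} {u : Z ⟶ A ⊙ₗ B.pow m} (h : u ≫ A ⊴ₗ B.base m = c) :
    B.coords A (u ≫ A ⊴ₗ B.matrixMap C) (B.matrixMap_weil_base A C h) =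
      C.smulTuple (B.coords A u h) := by
  funext i
  have : Over.precomp (B.weil_additive A) u h (B.weilMap A _ (B.linComb C i)) =
      C.smulTuple (B.coords A u h) i := by
    rw [linComb, map_sum, map_sum]
    refine Finset.sum_congr rfl fun j _ => ?_
    rw [map_nsmul, map_nsmul]
    rfl
  refine Eq.trans (Over.ext ?_) this
  change (u ≫ A ⊴ₗ B.matrixMap C) ≫ A ⊴ₗ B.π n i = u ≫ A ⊴ₗ (B.linComb C i).1
  rw [Category.assoc, ← actionHomRight_comp, matrixMap_π]

/-- The matrix identities say that `fst`, `snd`, `inl`, `inr` form a biproduct. Acting on tuples in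
the monoid of morphisms over a fixed base, they give the bijection `(u, v) ↦ inl u + inr v`. -/
lemma isPullback_matrixMap (A : Weil) {p m n s : ℕ} {fst : Matrix (Fin m) (Fin p) ℕ}
    {snd : Matrix (Fin n) (Fin p) ℕ} {f : Matrix (Fin s) (Fin m) ℕ} {g : Matrix (Fin s) (Fin n) ℕ}
    (w : f * fst = g * snd) {inl : Matrix (Fin p) (Fin m) ℕ} {inr : Matrix (Fin p) (Fin n) ℕ}
    (h₁₁ : fst * inl = 1) (h₁₂ : fst * inr = 0) (h₂₁ : snd * inl = 0) (h₂₂ : snd * inr = 1)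
    (h : inl * fst + inr * snd = 1) :
    IsPullback (A ⊴ₗ B.matrixMap fst) (A ⊴ₗ B.matrixMap snd) (A ⊴ₗ B.matrixMap f)
      (A ⊴ₗ B.matrixMap g) := by
  refine isPullback_iff_isPowerAlong.2 ⟨fun _ => ?_, fun {Z} v u' hu => ?_, fun {Z} x y h1 h2 => ?_⟩
  · rw [← actionHomRight_comp, ← actionHomRight_comp, ← matrixMap_mul, ← matrixMap_mul, w]
  · obtain ⟨u, rfl⟩ : ∃ u, u' = fun _ => u := ⟨u' (), rfl⟩
    -- The only use of the compatibility of `u` and `v`: it forces them over the same base, so that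
    -- their coordinates can be added.
    have hc : u ≫ A ⊴ₗ B.base m = v ≫ A ⊴ₗ B.base n := by
      rw [← B.matrixMap_base f, ← B.matrixMap_base g, actionHomRight_comp, actionHomRight_comp,
        ← Category.assoc, hu (), Category.assoc]
    obtain ⟨x, hx, e⟩ := B.exists_coords_eq A
      (inl.smulTuple (B.coords A u hc) + inr.smulTuple (B.coords A v rfl))
    refine ⟨x, B.coords_injective A (h := B.matrixMap_weil_base A snd hx) (h' := rfl) ?_,
      fun _ => B.coords_injective A (h := B.matrixMap_weil_base A fst hx) (h' := hc) ?_⟩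
    · rw [B.coords_matrixMap A _ hx, e, smulTuple_add, ← mul_smulTuple, ← mul_smulTuple, h₂₁, h₂₂,
        zero_smulTuple, one_smulTuple, zero_add]
    · rw [B.coords_matrixMap A _ hx, e, smulTuple_add, ← mul_smulTuple, ← mul_smulTuple, h₁₁, h₁₂,
        zero_smulTuple, one_smulTuple, add_zero]
  · replace h2 := h2 ()
    have hb : x ≫ A ⊴ₗ B.base p = y ≫ A ⊴ₗ B.base p := by
      rw [← B.matrixMap_base snd, actionHomRight_comp, ← Category.assoc, h1, Category.assoc]
    have key {z : Z ⟶ A ⊙ₗ B.pow p} (hz : z ≫ A ⊴ₗ B.base p = y ≫ A ⊴ₗ B.base p) :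
        B.coords A z hz =
          inl.smulTuple (B.coords A (z ≫ A ⊴ₗ B.matrixMap fst) (B.matrixMap_weil_base A fst hz)) +
          inr.smulTuple (B.coords A (z ≫ A ⊴ₗ B.matrixMap snd) (B.matrixMap_weil_base A snd hz)) := by
      rw [B.coords_matrixMap A _ hz, B.coords_matrixMap A _ hz, ← mul_smulTuple, ← mul_smulTuple, ← add_smulTuple,
        h, one_smulTuple]
    refine B.coords_injective A (h := hb) (h' := rfl) ((key hb).trans (Eq.trans ?_ (key rfl).symm))
    congr! 3

/-- Over a terminal object every cone is compatible, so the injections `(1, 0)` and `(0, 1)` exist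
and the pullback is a product. Since matrices can be added, it is a biproduct. -/
lemma preserves_pullback (A : Weil) {S P Y₁ Y₂ : NBullet} (hS : IsTerminal S) {fst : P ⟶ Y₁}
    {snd : P ⟶ Y₂} {f : Y₁ ⟶ S} {g : Y₂ ⟶ S} (h : IsPullback fst snd f g) :
    IsPullback (A ⊴ₗ B.matrixMap fst.mat) (A ⊴ₗ B.matrixMap snd.mat) (A ⊴ₗ B.matrixMap f.mat)
      (A ⊴ₗ B.matrixMap g.mat) := by
  let inl : Y₁ ⟶ P := h.lift (𝟙 _) ⟨0⟩ (hS.hom_ext _ _)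
  let inr : Y₂ ⟶ P := h.lift ⟨0⟩ (𝟙 _) (hS.hom_ext _ _)
  have h₁₁ : fst.mat * inl.mat = 1 := congrArg NBullet.Hom.mat (h.lift_fst _ _ (hS.hom_ext _ _))
  have h₂₁ : snd.mat * inl.mat = 0 := congrArg NBullet.Hom.mat (h.lift_snd _ _ (hS.hom_ext _ _))
  have h₁₂ : fst.mat * inr.mat = 0 := congrArg NBullet.Hom.mat (h.lift_fst _ _ (hS.hom_ext _ _))
  have h₂₂ : snd.mat * inr.mat = 1 := congrArg NBullet.Hom.mat (h.lift_snd _ _ (hS.hom_ext _ _))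
  -- The sum of matrices is packaged as an endomorphism of `P`, so that the uniqueness part of the
  -- pullback identifies it with the identity.
  let e : P ⟶ P := ⟨inl.mat * fst.mat + inr.mat * snd.mat⟩
  have he : e = 𝟙 P := by
    refine h.hom_ext (NBullet.Hom.ext ?_) (NBullet.Hom.ext ?_)
    · change fst.mat * (inl.mat * fst.mat + inr.mat * snd.mat) = fst.mat * 1
      rw [Matrix.mul_add, ← Matrix.mul_assoc, ← Matrix.mul_assoc, h₁₁, h₁₂, Matrix.one_mul,
        Matrix.zero_mul, add_zero, Matrix.mul_one]
    · change snd.mat * (inl.mat * fst.mat + inr.mat * snd.mat) = snd.mat * 1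
      rw [Matrix.mul_add, ← Matrix.mul_assoc, ← Matrix.mul_assoc, h₂₁, h₂₂, Matrix.one_mul,
        Matrix.zero_mul, zero_add, Matrix.mul_one]
  exact B.isPullback_matrixMap A (congrArg NBullet.Hom.mat h.w) h₁₁ h₁₂ h₂₁ h₂₂
    (congrArg NBullet.Hom.mat he)

end DifferentialBundle

end

theorem mainTheorem4 {X : Type u} [Category.{v} X] [MonoidalLeftAction Weil X]
    [IsTangentActegory X] (B : DifferentialBundle X) :
    ∃ α : B.functor.OplaxLeftLinear Weil,
      (∀ (A : Weil) (k : NBullet), α.δₗ A k = B.alphaHat A k) ∧ IsLaxDifferential B.functor α := by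
  exact ⟨B.oplaxLinear, fun _ _ => rfl, ⟨fun A _ _ _ _ hS _ _ _ _ h => B.preserves_pullback A hS h,
    fun A _ _ f => B.isPullback_alpha A f⟩⟩
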